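/- Let $\alpha>0$, $R>0$, let $p,q\in\mathbb C$ with $q\neq0$, and put $\lambda=(p-q)/\alpha$. Let $s:[0,R]\to(0,\infty)$ be continuously differentiable with $\dot s(r)>0$ for all $r\in[0,R]$ (downsloping bottom), let $\mathcal D=\{(r,z):0\le r\le R,\ 0\le z\le s(r)\}$, and let $\beta:\mathcal D\to\mathbb C$ be continuous. Consider complex-valued solutions $v\in C^3(\mathcal D)$ (smooth up to the boundary) of the initial-boundary-value problem $$(1+q\beta)\,v_r+\alpha^2q\,v_{zzr}=\mathrm i\lambda\,(\alpha^2v_{zz}+\beta v)\quad\text{in }\mathcal D,$$ $$v(0,z)=v_0(z)\ \ (0\le z\le s(0)),\qquad v(r,0)=0,\quad v(r,s(r))=0,\quad v_r(r,s(r))=0\ \ (0\le r\le R).$$ For a function $w$ on $[0,l]$ write $\|w\|_0^2=\int_0^{l}|w|^2\,dz$, $\|w\|_1^2=\|w\|_0^2+\|w'\|_0^2$ and $\|w\|_2^2=\|w\|_1^2+\|w''\|_0^2$; for $v(r,\cdot)$ these norms are taken on $[0,s(r)]$, and for $v_0$ on $[0,s(0)]$. For every $M\in\mathbb R$ there is $\delta>0$,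 depending only on $M$, such that the following holds for all data $\alpha,p,q,R,s,\beta$ as above. Assume that one of the following two conditions is satisfied: (a) $\mathrm{Im}(q^{-1}+\beta)$ is nonzero and of one sign on $\mathcal D$, i.e. it is $>0$ everywhere on $\mathcal D$ or $<0$ everywhere on $\mathcal D$; (b) $|\mathrm{Re}(q^{-1}+\beta)|\le M$ on $\mathcal D$ and $\frac1\alpha\max_{0\le r\le R}s(r)\le\delta$. Then the problem is stable in $L^2$, $H^1$ and $H^2$: for each $\ell\in\{0,1,2\}$ there is a constant $C>0$, depending only on the data $\alpha,p,q,R,s,\beta$ (not on $v$, $v_0$ or $r$), such that every solution $v$ with any initial value $v_0$ satisfies $$\|v(r,\cdot)\|_\ell\le C\,\|v_0\|_\ell,\qquad 0\le r\le R.$$ -/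

import Mathlib

/-! The wide-angle parabolic equation `(WA)` of underwater acoustics on a domain with a
range-dependent bottom `z = s r`, in the variables `x = (r, z)`. -/

namespace WideAngle

/-- The closed domain `{(r, z) : 0 ≤ r ≤ R, 0 ≤ z ≤ s r}`. -/
def domain (R : ℝ) (s : ℝ → ℝ) : Set (ℝ × ℝ) :=
  {x | x.1 ∈ Set.Icc 0 R ∧ x.2 ∈ Set.Icc 0 (s x.1)}

/-- Partial derivative in the range variable `r`, relative to a set `D` (at boundary points of `D`
the derivative within `D` is taken). -/
noncomputable def dr (D : Set (ℝ × ℝ)) (v : ℝ × ℝ → ℂ) (x : ℝ × ℝ) : ℂ :=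
  fderivWithin ℝ v D x (1, 0)

/-- Partial derivative in the depth variable `z`, relative to a set `D`. -/
noncomputable def dz (D : Set (ℝ × ℝ)) (v : ℝ × ℝ → ℂ) (x : ℝ × ℝ) : ℂ :=
  fderivWithin ℝ v D x (0, 1)

/-- The constant `λ = (p - q) / α`. -/
noncomputable def lam (α : ℝ) (p q : ℂ) : ℂ := (p - q) / (α : ℂ)

/-- `v` is a classical solution (of class `C³` up to the boundary) of the problem consisting of
the equation `(1 + q β) v_r + α² q v_zzr = i λ (α² v_zz + β v)`, the initial condition, the
homogeneous Dirichlet conditions on the surface and on the bottom, and the additional bottom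
condition `v_r (r, s r) = 0`. -/
structure IsSolution (α : ℝ) (p q : ℂ) (R : ℝ) (s : ℝ → ℝ) (β : ℝ × ℝ → ℂ) (v₀ : ℝ → ℂ)
    (v : ℝ × ℝ → ℂ) : Prop where
  smooth : ContDiffOn ℝ 3 v (domain R s)
  equation : ∀ x ∈ domain R s,
    (1 + q * β x) * dr (domain R s) v x
        + (α : ℂ) ^ 2 * q * dr (domain R s) (dz (domain R s) (dz (domain R s) v)) x
      = Complex.I * lam α p q *
          ((α : ℂ) ^ 2 * dz (domain R s) (dz (domain R s) v) x + β x * v x)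
  initial : ∀ z ∈ Set.Icc 0 (s 0), v (0, z) = v₀ z
  surface : ∀ r ∈ Set.Icc 0 R, v (r, 0) = 0
  bottom : ∀ r ∈ Set.Icc 0 R, v (r, s r) = 0
  bottom_dr : ∀ r ∈ Set.Icc 0 R, dr (domain R s) v (r, s r) = 0

/-- The `L²` norm of `w` on `[0, l]`. -/
noncomputable def normL2 (l : ℝ) (w : ℝ → ℂ) : ℝ :=
  Real.sqrt (∫ z in (0 : ℝ)..l, ‖w z‖ ^ 2)

/-- The `H¹` norm of a `C¹` function `w` on `[0, l]`. -/
noncomputable def normH1 (l : ℝ) (w : ℝ → ℂ) : ℝ :=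
  Real.sqrt (normL2 l w ^ 2 + normL2 l (derivWithin w (Set.Icc 0 l)) ^ 2)

/-- The `H²` norm of a `C²` function `w` on `[0, l]`. -/
noncomputable def normH2 (l : ℝ) (w : ℝ → ℂ) : ℝ :=
  Real.sqrt (normH1 l w ^ 2 + normL2 l (iteratedDerivWithin 2 w (Set.Icc 0 l)) ^ 2)

/-- Stability with respect to a family of norms `N l` on `[0, l]`: one constant, independent of
the solution, of the initial value and of the range, bounds every solution by its initial
value. -/
def Stable (N : ℝ → (ℝ → ℂ) → ℝ) (α : ℝ) (p q : ℂ) (R : ℝ) (s : ℝ → ℝ) (β : ℝ × ℝ → ℂ) : Prop :=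
  ∃ C : ℝ, 0 < C ∧ ∀ (v₀ : ℝ → ℂ) (v : ℝ × ℝ → ℂ), IsSolution α p q R s β v₀ v →
    ∀ r ∈ Set.Icc 0 R, N (s r) (fun z => v (r, z)) ≤ C * N (s 0) v₀

end WideAngle

open Set

namespace WideAngle

/-! Put κ = iλ/q and u = v_r - κ v, the "defect" of v. Dividing the equation by q and subtracting κ
times its elliptic part cancels v_zz on the right: for each fixed r, α² u_zz + (q⁻¹ + β) u = -(κ/q)
v. The boundary conditions, including v_r = 0 on the bottom, make u vanish at z = 0 and z = s r.
Under (a) or (b) this Dirichlet problem has an estimate uniform in r (`exists_gradientBound_of_im`,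
`gradientBound_of_re`), upgraded to pointwise bounds on u, u_z, u_zz by
`GradientBound.exists_pointwise`.

What remains is the ODE v_r = κ v + u along horizontal segments, and likewise for v_z and v_zz with
u_z and u_zz. As s increases, each segment followed to the left stays in the domain until it meets
the initial line or the bottom (`exists_entry`). On the bottom v = 0; since also v_r = 0 and s' > 0,
v_z = 0 there; differentiating v_z = 0 along the bottom expresses v_zz through u_z
(`deriv_smul_dz_dz_bottom`). So every entry value is initial data, zero, or controlled by the
elliptic bound.

The bound on u involves the L² norm of v at the same range, so the L² estimate is closed with a
supremum weighted by exp (-μ t), μ large (`le_two_mul_exp_of_improve`). The H¹ and H² estimates then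
follow by direct integration in range. -/

/-- The standing assumptions on a downsloping bottom `z = s r`, `0 ≤ r ≤ R`. -/
structure Downsloping (R : ℝ) (s : ℝ → ℝ) : Prop where
  pos_R : 0 < R
  contDiffOn : ContDiffOn ℝ 1 s (Icc 0 R)
  pos : ∀ r ∈ Icc 0 R, 0 < s r
  deriv_pos : ∀ r ∈ Icc 0 R, 0 < derivWithin s (Icc 0 R) r

/-! ### Geometry of the domain under a downsloping bottom. -/

namespace Downsloping

variable {R : ℝ} {s : ℝ → ℝ}

theorem hasDerivWithinAt (h : Downsloping R s) {r : ℝ} (hr : r ∈ Icc 0 R) :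
    HasDerivWithinAt s (derivWithin s (Icc 0 R) r) (Icc 0 R) r :=
  ((h.contDiffOn.differentiableOn (by norm_num)) r hr).hasDerivWithinAt

theorem strictMonoOn (h : Downsloping R s) : StrictMonoOn s (Icc 0 R) := by
  refine strictMonoOn_of_deriv_pos (convex_Icc _ _) h.contDiffOn.continuousOn fun x hx => ?_
  rw [interior_Icc] at hx
  have := h.deriv_pos x (Ioo_subset_Icc_self hx)
  rwa [derivWithin_of_mem_nhds (Icc_mem_nhds hx.1 hx.2)] at this

theorem exists_le_deriv (h : Downsloping R s) :
    ∃ c > 0, ∀ r ∈ Icc 0 R, c ≤ derivWithin s (Icc 0 R) r := by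
  have hc : ContinuousOn (derivWithin s (Icc 0 R)) (Icc 0 R) :=
    h.contDiffOn.continuousOn_derivWithin (uniqueDiffOn_Icc h.pos_R) le_rfl
  obtain ⟨x, hx, hmin⟩ := isCompact_Icc.exists_isMinOn (nonempty_Icc.2 h.pos_R.le) hc
  exact ⟨_, h.deriv_pos x hx, fun r hr => hmin hr⟩

/-- Flattening the bottom: compactness, unique differentiability and density of the interior are all
transported from a rectangle. -/
theorem image_box (h : Downsloping R s) :
    (fun x : ℝ × ℝ => (x.1, x.2 * s x.1)) '' (Icc 0 R ×ˢ Icc 0 1) = domain R s := by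
  ext ⟨r, z⟩
  constructor
  · rintro ⟨⟨t, y⟩, ⟨ht, hy⟩, he⟩
    obtain ⟨rfl, rfl⟩ := Prod.mk.inj he
    have := h.pos t ht
    exact ⟨ht, mul_nonneg hy.1 this.le, mul_le_of_le_one_left this.le hy.2⟩
  · rintro ⟨hr, hz⟩
    have := h.pos r hr
    refine ⟨(r, z / s r), ⟨hr, div_nonneg hz.1 this.le, (div_le_one this).2 hz.2⟩, ?_⟩
    simp [div_mul_cancel₀ z this.ne']

theorem continuousOn_box (h : Downsloping R s) :
    ContinuousOn (fun x : ℝ × ℝ => (x.1, x.2 * s x.1)) (Icc 0 R ×ˢ Icc 0 1) :=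
  continuousOn_fst.prodMk (continuousOn_snd.mul
    (h.contDiffOn.continuousOn.comp continuousOn_fst fun _ hx => hx.1))

theorem isCompact_domain (h : Downsloping R s) : IsCompact (domain R s) := by
  rw [← h.image_box]
  exact (isCompact_Icc.prod isCompact_Icc).image_of_continuousOn h.continuousOn_box

theorem uniqueDiffOn_domain (h : Downsloping R s) : UniqueDiffOn ℝ (domain R s) := by
  rw [← h.image_box]
  rintro _ ⟨⟨t, y⟩, hx, rfl⟩
  have hfst : HasFDerivWithinAt Prod.fst (ContinuousLinearMap.fst ℝ ℝ ℝ)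
      (Icc 0 R ×ˢ Icc 0 1) (t, y) := hasFDerivWithinAt_fst
  have hs := HasDerivWithinAt.comp_hasFDerivWithinAt (t, y)
    (h.hasDerivWithinAt (r := (t, y).1) hx.1) hfst fun _ hx => hx.1
  have hF := hfst.prodMk
    ((hasFDerivWithinAt_snd (𝕜 := ℝ) (p := (t, y)) (s := Icc 0 R ×ˢ Icc 0 1)).mul hs)
  -- The flattening map has a surjective derivative because `s t ≠ 0`, so unique differentiability
  -- passes to the image.
  refine hF.uniqueDiffWithinAt
    (((uniqueDiffOn_Icc h.pos_R).prod (uniqueDiffOn_Icc one_pos)) _ hx)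
    (Function.Surjective.denseRange ?_)
  rintro ⟨a, b⟩
  have := (h.pos t hx.1).ne'
  refine ⟨(a, (b - y * (derivWithin s (Icc 0 R) t * a)) / s t), ?_⟩
  simp
  field_simp
  ring

/-- Needed for the symmetry of second derivatives at boundary points. -/
theorem subset_closure_interior (h : Downsloping R s) :
    domain R s ⊆ closure (interior (domain R s)) := by
  have hcl : closure (Ioo 0 R ×ˢ Ioo 0 1 : Set (ℝ × ℝ)) = Icc 0 R ×ˢ Icc 0 1 := by
    rw [closure_prod_eq, closure_Ioo h.pos_R.ne, closure_Ioo (by norm_num)]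
  have h1 := (hcl ▸ h.continuousOn_box).image_closure
  rw [hcl, h.image_box] at h1
  refine h1.trans (closure_mono ?_)
  have hopen : IsOpen ((Ioo 0 R ×ˢ Ioi 0) ∩ (fun x : ℝ × ℝ => s x.1 - x.2) ⁻¹' Ioi 0) := by
    refine ContinuousOn.isOpen_inter_preimage ?_ (isOpen_Ioo.prod isOpen_Ioi) isOpen_Ioi
    exact (h.contDiffOn.continuousOn.comp continuousOn_fst
      fun _ hx => Ioo_subset_Icc_self hx.1).sub continuousOn_snd
  refine Subset.trans ?_ (interior_maximal ?_ hopen)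
  · rintro _ ⟨⟨t, y⟩, ⟨ht, hy⟩, rfl⟩
    have := h.pos t (Ioo_subset_Icc_self ht)
    refine ⟨⟨ht, mul_pos hy.1 this⟩, ?_⟩
    have := mul_lt_of_lt_one_left this hy.2
    simpa using this
  · rintro ⟨t, z⟩ ⟨⟨ht, hz⟩, hs⟩
    exact ⟨Ioo_subset_Icc_self ht, le_of_lt hz, (sub_pos.1 hs).le⟩

/-- Every point of the domain is joined to the initial line or to the bottom by a horizontal
segment on its left. -/
theorem exists_entry (h : Downsloping R s) {r z : ℝ} (hx : (r, z) ∈ domain R s) :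
    ∃ a ∈ Icc 0 r, (∀ t ∈ Icc a r, (t, z) ∈ domain R s) ∧
      ((a = 0 ∧ z ≤ s 0) ∨ (z = s a ∧ s 0 < z)) := by
  obtain ⟨hr, hz⟩ := hx
  simp only at hr hz
  -- Monotonicity of `s` enters here: a depth admissible at `a` stays admissible at all larger
  -- ranges.
  have key : ∀ a ∈ Icc 0 r, z ≤ s a → ∀ t ∈ Icc a r, (t, z) ∈ domain R s := by
    intro a ha hza t ht
    have ht' : t ∈ Icc 0 R := ⟨ha.1.trans ht.1, ht.2.trans hr.2⟩
    exact ⟨ht', hz.1,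
      hza.trans (h.strictMonoOn.monotoneOn ⟨ha.1, ha.2.trans hr.2⟩ ht' ht.1)⟩
  rcases le_or_gt z (s 0) with h0 | h0
  · exact ⟨0, ⟨le_rfl, hr.1⟩, key 0 ⟨le_rfl, hr.1⟩ h0, Or.inl ⟨rfl, h0⟩⟩
  · obtain ⟨a, ha, hza⟩ := intermediate_value_Icc hr.1
      (h.contDiffOn.continuousOn.mono (Icc_subset_Icc_right hr.2)) ⟨h0.le, hz.2⟩
    exact ⟨a, ha, key a ha hza.ge, Or.inr ⟨hza.symm, h0⟩⟩

end Downsloping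

/-! ### Partial derivatives up to the boundary. -/

section Calculus

variable {R : ℝ} {s : ℝ → ℝ} {f : ℝ × ℝ → ℂ}

theorem contDiffOn_dz (h : Downsloping R s) {m n : WithTop ℕ∞} (hf : ContDiffOn ℝ n f (domain R s))
    (hmn : m + 1 ≤ n) : ContDiffOn ℝ m (dz (domain R s) f) (domain R s) :=
  (hf.fderivWithin h.uniqueDiffOn_domain hmn).clm_apply contDiffOn_const

theorem contDiffOn_dr (h : Downsloping R s) {m n : WithTop ℕ∞} (hf : ContDiffOn ℝ n f (domain R s))
    (hmn : m + 1 ≤ n) : ContDiffOn ℝ m (dr (domain R s) f) (domain R s) :=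
  (hf.fderivWithin h.uniqueDiffOn_domain hmn).clm_apply contDiffOn_const

theorem dz_dr_comm (h : Downsloping R s) (hf : ContDiffOn ℝ 2 f (domain R s)) {x : ℝ × ℝ}
    (hx : x ∈ domain R s) :
    dz (domain R s) (dr (domain R s) f) x = dr (domain R s) (dz (domain R s) f) x := by
  have hu := h.uniqueDiffOn_domain
  have hd : DifferentiableWithinAt ℝ (fderivWithin ℝ f (domain R s)) (domain R s) x :=
    (hf.fderivWithin hu (m := 1) (by norm_num)).differentiableOn (by norm_num) x hx
  have hsymm := (hf x hx).isSymmSndFDerivWithinAt (by simp) hu (h.subset_closure_interior hx) hx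
  have key : ∀ a b : ℝ × ℝ, fderivWithin ℝ (fun y => fderivWithin ℝ f (domain R s) y a)
      (domain R s) x b = fderivWithin ℝ (fderivWithin ℝ f (domain R s)) (domain R s) x b a := by
    intro a b
    rw [fderivWithin_clm_apply (hu x hx) hd (differentiableWithinAt_const a)]
    simp
  exact (key _ _).trans ((hsymm _ _).trans (key _ _).symm)

theorem hasDerivWithinAt_depth (hf : DifferentiableOn ℝ f (domain R s)) {r z : ℝ}
    (hx : (r, z) ∈ domain R s) :
    HasDerivWithinAt (fun y => f (r, y)) (dz (domain R s) f (r, z)) (Icc 0 (s r)) z :=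
  (hf _ hx).hasFDerivWithinAt.comp_hasDerivWithinAt z
    (f := fun y => (r, y)) ((hasDerivWithinAt_const _ _ _).prodMk (hasDerivWithinAt_id _ _))
    fun _ hy => ⟨hx.1, hy⟩

theorem hasDerivWithinAt_range (hf : DifferentiableOn ℝ f (domain R s)) {z : ℝ} {S : Set ℝ}
    (hS : ∀ t ∈ S, (t, z) ∈ domain R s) {t : ℝ} (ht : t ∈ S) :
    HasDerivWithinAt (fun y => f (y, z)) (dr (domain R s) f (t, z)) S t :=
  (hf _ (hS t ht)).hasFDerivWithinAt.comp_hasDerivWithinAt t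
    (f := fun y => (y, z)) ((hasDerivWithinAt_id _ _).prodMk (hasDerivWithinAt_const _ _ _)) hS

theorem hasDerivWithinAt_bottom (h : Downsloping R s) (hf : DifferentiableOn ℝ f (domain R s))
    {t : ℝ} (ht : t ∈ Icc 0 R) :
    HasDerivWithinAt (fun y => f (y, s y))
      (dr (domain R s) f (t, s t) + derivWithin s (Icc 0 R) t • dz (domain R s) f (t, s t))
      (Icc 0 R) t := by
  have hm : MapsTo (fun y => (y, s y)) (Icc 0 R) (domain R s) :=
    fun y hy => ⟨hy, (h.pos y hy).le, le_rfl⟩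
  have := (hf _ (hm ht)).hasFDerivWithinAt.comp_hasDerivWithinAt t
    (f := fun y => (y, s y)) ((hasDerivWithinAt_id _ _).prodMk (h.hasDerivWithinAt ht)) hm
  refine this.congr_deriv ?_
  rw [dr, dz, ← map_smul, ← map_add]
  simp

/-- The tangential derivative of a function that is zero along the bottom. It is applied to `v` and
then to `v_z`. -/
theorem dr_add_smul_dz_bottom (h : Downsloping R s) (hf : DifferentiableOn ℝ f (domain R s))
    (h0 : ∀ t ∈ Icc 0 R, f (t, s t) = 0) {t : ℝ} (ht : t ∈ Icc 0 R) :
    dr (domain R s) f (t, s t) + derivWithin s (Icc 0 R) t • dz (domain R s) f (t, s t) = 0 := by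
  refine (uniqueDiffOn_Icc h.pos_R t ht).eq_deriv _ (hasDerivWithinAt_bottom h hf ht) ?_
  exact (hasDerivWithinAt_const t (Icc 0 R) (0 : ℂ)).congr h0 (h0 t ht)

theorem dr_surface (h : Downsloping R s) (hf : DifferentiableOn ℝ f (domain R s))
    (h0 : ∀ t ∈ Icc 0 R, f (t, 0) = 0) {t : ℝ} (ht : t ∈ Icc 0 R) :
    dr (domain R s) f (t, 0) = 0 := by
  refine (uniqueDiffOn_Icc h.pos_R t ht).eq_deriv _ (hasDerivWithinAt_range hf
    (fun y hy => ⟨hy, le_rfl, (h.pos y hy).le⟩) ht) ?_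
  exact (hasDerivWithinAt_const t (Icc 0 R) (0 : ℂ)).congr h0 (h0 t ht)

end Calculus

/-! ### The Dirichlet problem on one depth interval. -/

section Interval

variable {l : ℝ}

theorem intervalIntegrable_of_continuousOn {E : Type*} [NormedAddCommGroup E] (hl : 0 ≤ l)
    {h : ℝ → E} (hh : ContinuousOn h (Icc 0 l)) :
    IntervalIntegrable h MeasureTheory.volume 0 l :=
  ContinuousOn.intervalIntegrable_of_Icc hl hh

/-- Cauchy–Schwarz against the constant 1, read off from the nonnegativity of the variance of `h`
about its mean `m`. -/
theorem sq_integral_le (hl : 0 < l) {h : ℝ → ℝ} (hh : ContinuousOn h (Icc 0 l)) :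
    (∫ z in (0 : ℝ)..l, h z) ^ 2 ≤ l * ∫ z in (0 : ℝ)..l, h z ^ 2 := by
  set m := (∫ z in (0 : ℝ)..l, h z) / l with hm
  have hi := intervalIntegrable_of_continuousOn hl.le hh
  have hi2 : IntervalIntegrable (fun z => h z ^ 2) MeasureTheory.volume 0 l :=
    intervalIntegrable_of_continuousOn hl.le (hh.pow 2)
  have h0 : 0 ≤ ∫ z in (0 : ℝ)..l, (h z - m) ^ 2 :=
    intervalIntegral.integral_nonneg hl.le fun _ _ => sq_nonneg _
  have h1 : ∫ z in (0 : ℝ)..l, (h z - m) ^ 2 =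
      (∫ z in (0 : ℝ)..l, h z ^ 2) - 2 * m * (∫ z in (0 : ℝ)..l, h z) + m ^ 2 * l := by
    have : ∀ z, (h z - m) ^ 2 = h z ^ 2 - 2 * m * h z + m ^ 2 := fun z => by ring
    simp only [this]
    rw [intervalIntegral.integral_add (hi2.sub (hi.const_mul _)) (by simp),
      intervalIntegral.integral_sub hi2 (hi.const_mul _), intervalIntegral.integral_const_mul]
    simp [mul_comm]
  have h2 : ∫ z in (0 : ℝ)..l, h z = m * l := by rw [hm]; field_simp
  rw [h1, h2] at h0
  rw [h2]
  nlinarith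

theorem norm_sub_le_integral {u u₁ : ℝ → ℂ} (hl : 0 ≤ l)
    (hu : ∀ z ∈ Icc 0 l, HasDerivWithinAt u (u₁ z) (Icc 0 l) z) (hc : ContinuousOn u₁ (Icc 0 l))
    {a b : ℝ} (ha : a ∈ Icc 0 l) (hb : b ∈ Icc 0 l) :
    ‖u b - u a‖ ≤ ∫ z in (0 : ℝ)..l, ‖u₁ z‖ := by
  wlog hab : a ≤ b generalizing a b
  · rw [norm_sub_rev]
    exact this hb ha (le_of_not_ge hab)
  have hsub : Icc a b ⊆ Icc 0 l := Icc_subset_Icc ha.1 hb.2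
  rw [← intervalIntegral.integral_eq_sub_of_hasDerivAt_of_le hab
    (fun z hz => ((hu z (hsub hz)).mono hsub).continuousWithinAt)
    (fun z hz => (hu z (hsub (Ioo_subset_Icc_self hz))).hasDerivAt
      (Icc_mem_nhds (ha.1.trans_lt hz.1) (hz.2.trans_le hb.2)))
    ((hc.mono hsub).intervalIntegrable_of_Icc hab)]
  refine (intervalIntegral.norm_integral_le_integral_norm hab).trans ?_
  exact intervalIntegral.integral_mono_interval ha.1 hab hb.2
    (Filter.Eventually.of_forall fun _ => norm_nonneg _)
    (intervalIntegrable_of_continuousOn hl hc.norm)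

theorem integral_eq_sub_of_hasDerivWithinAt {u u₁ : ℝ → ℂ} (hl : 0 ≤ l)
    (hu : ∀ z ∈ Icc 0 l, HasDerivWithinAt u (u₁ z) (Icc 0 l) z)
    (hc : ContinuousOn u₁ (Icc 0 l)) :
    ∫ z in (0 : ℝ)..l, u₁ z = u l - u 0 :=
  intervalIntegral.integral_eq_sub_of_hasDerivAt_of_le hl
    (fun z hz => (hu z hz).continuousWithinAt)
    (fun z hz => (hu z (Ioo_subset_Icc_self hz)).hasDerivAt (Icc_mem_nhds hz.1 hz.2))
    (intervalIntegrable_of_continuousOn hl hc)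

/-- A `C²` function `u` on `[0, l]` vanishing at both ends, with its first two derivatives. -/
structure DirichletProfile (l : ℝ) (u u₁ u₂ : ℝ → ℂ) : Prop where
  pos : 0 < l
  deriv : ∀ z ∈ Icc 0 l, HasDerivWithinAt u (u₁ z) (Icc 0 l) z
  deriv₁ : ∀ z ∈ Icc 0 l, HasDerivWithinAt u₁ (u₂ z) (Icc 0 l) z
  continuousOn₂ : ContinuousOn u₂ (Icc 0 l)
  left : u 0 = 0
  right : u l = 0

namespace DirichletProfile

variable {u u₁ u₂ F γ : ℝ → ℂ} {α Γ : ℝ}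

theorem continuousOn (h : DirichletProfile l u u₁ u₂) : ContinuousOn u (Icc 0 l) :=
  fun z hz => (h.deriv z hz).continuousWithinAt

theorem continuousOn₁ (h : DirichletProfile l u u₁ u₂) : ContinuousOn u₁ (Icc 0 l) :=
  fun z hz => (h.deriv₁ z hz).continuousWithinAt

theorem continuousOn_inner (h : DirichletProfile l u u₁ u₂) :
    ContinuousOn (fun z => inner ℂ (u z) (u₂ z)) (Icc 0 l) :=
  ContinuousOn.inner (𝕜 := ℂ) h.continuousOn h.continuousOn₂

theorem sq_norm_le (h : DirichletProfile l u u₁ u₂) {z : ℝ} (hz : z ∈ Icc 0 l) :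
    ‖u z‖ ^ 2 ≤ l * ∫ y in (0 : ℝ)..l, ‖u₁ y‖ ^ 2 := by
  refine le_trans ?_ (sq_integral_le h.pos h.continuousOn₁.norm)
  gcongr
  simpa [h.left] using norm_sub_le_integral h.pos.le h.deriv h.continuousOn₁
    (left_mem_Icc.2 h.pos.le) hz

/-- Since `u` vanishes at both ends, `u₁` has mean zero; hence its value at any point is an average
of differences `u₁ z - u₁ y`, each at most the integral of `‖u₂‖`. -/
theorem sq_norm_deriv_le (h : DirichletProfile l u u₁ u₂) {z : ℝ} (hz : z ∈ Icc 0 l) :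
    ‖u₁ z‖ ^ 2 ≤ l * ∫ y in (0 : ℝ)..l, ‖u₂ y‖ ^ 2 := by
  refine le_trans ?_ (sq_integral_le h.pos h.continuousOn₂.norm)
  gcongr
  have h0 : ∫ y in (0 : ℝ)..l, u₁ y = 0 := by
    rw [integral_eq_sub_of_hasDerivWithinAt h.pos.le h.deriv h.continuousOn₁, h.left, h.right,
      sub_zero]
  have h1 : ∫ y in (0 : ℝ)..l, (u₁ z - u₁ y) = l * u₁ z := by
    rw [intervalIntegral.integral_sub (by simp)
      (intervalIntegrable_of_continuousOn h.pos.le h.continuousOn₁), h0]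
    simp
  have h2 := intervalIntegral.norm_integral_le_of_norm_le_const (a := 0) (b := l)
    (f := fun y => u₁ z - u₁ y) (C := ∫ y in (0 : ℝ)..l, ‖u₂ y‖) fun y hy => by
      rw [uIoc_of_le h.pos.le] at hy
      exact norm_sub_le_integral h.pos.le h.deriv₁ h.continuousOn₂ (Ioc_subset_Icc_self hy) hz
  rw [h1, norm_mul, Complex.norm_real, Real.norm_of_nonneg h.pos.le, sub_zero,
    abs_of_pos h.pos, mul_comm] at h2
  exact le_of_mul_le_mul_right h2 h.pos

theorem integral_sq_le (h : DirichletProfile l u u₁ u₂) :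
    ∫ y in (0 : ℝ)..l, ‖u y‖ ^ 2 ≤ l ^ 2 * ∫ y in (0 : ℝ)..l, ‖u₁ y‖ ^ 2 := by
  refine (intervalIntegral.integral_mono_on h.pos.le
    (intervalIntegrable_of_continuousOn h.pos.le (h.continuousOn.norm.pow 2)) (by simp)
    fun z hz => h.sq_norm_le hz).trans_eq ?_
  simp
  ring

/-- Integration by parts: the integrand is the derivative of `inner ℂ (u z) (u₁ z)`, which vanishes
at both ends. -/
theorem integral_inner (h : DirichletProfile l u u₁ u₂) :
    ∫ z in (0 : ℝ)..l, (inner ℂ (u z) (u₂ z) + ((‖u₁ z‖ ^ 2 : ℝ) : ℂ)) = 0 := by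
  have hd : ∀ z ∈ Icc 0 l, HasDerivWithinAt (fun z => inner ℂ (u z) (u₁ z))
      (inner ℂ (u z) (u₂ z) + ((‖u₁ z‖ ^ 2 : ℝ) : ℂ)) (Icc 0 l) z := by
    intro z hz
    have := (h.deriv z hz).inner ℂ (h.deriv₁ z hz)
    rw [inner_self_eq_norm_sq_to_K] at this
    exact this.congr_deriv (by push_cast; rfl)
  rw [integral_eq_sub_of_hasDerivWithinAt h.pos.le hd, h.left, h.right]
  · simp
  · exact h.continuousOn_inner.add
      (Complex.continuous_ofReal.comp_continuousOn (h.continuousOn₁.norm.pow 2))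

theorem integral_re (h : DirichletProfile l u u₁ u₂) :
    ∫ z in (0 : ℝ)..l, (inner ℂ (u z) (u₂ z)).re = - ∫ z in (0 : ℝ)..l, ‖u₁ z‖ ^ 2 := by
  have hc := intervalIntegrable_of_continuousOn h.pos.le h.continuousOn_inner
  have hn : IntervalIntegrable (fun z => ‖u₁ z‖ ^ 2) MeasureTheory.volume 0 l :=
    intervalIntegrable_of_continuousOn h.pos.le (h.continuousOn₁.norm.pow 2)
  have hre : IntervalIntegrable (fun z => (inner ℂ (u z) (u₂ z)).re) MeasureTheory.volume 0 l :=
    intervalIntegrable_of_continuousOn h.pos.le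
      (Complex.continuous_re.comp_continuousOn h.continuousOn_inner)
  have hofr : IntervalIntegrable (fun z => ((‖u₁ z‖ ^ 2 : ℝ) : ℂ)) MeasureTheory.volume 0 l :=
    intervalIntegrable_of_continuousOn h.pos.le
      (Complex.continuous_ofReal.comp_continuousOn (h.continuousOn₁.norm.pow 2))
  have h0 := congrArg Complex.re h.integral_inner
  rw [← Complex.reCLM_apply, ← ContinuousLinearMap.intervalIntegral_comp_comm _
    (hc.add hofr)] at h0
  simp only [map_add, Complex.reCLM_apply, Complex.ofReal_re, Complex.zero_re] at h0
  rw [intervalIntegral.integral_add hre hn] at h0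
  linarith

theorem integral_im (h : DirichletProfile l u u₁ u₂) :
    ∫ z in (0 : ℝ)..l, (inner ℂ (u z) (u₂ z)).im = 0 := by
  have hc := intervalIntegrable_of_continuousOn h.pos.le h.continuousOn_inner
  have hofr : IntervalIntegrable (fun z => ((‖u₁ z‖ ^ 2 : ℝ) : ℂ)) MeasureTheory.volume 0 l :=
    intervalIntegrable_of_continuousOn h.pos.le
      (Complex.continuous_ofReal.comp_continuousOn (h.continuousOn₁.norm.pow 2))
  have h0 := congrArg Complex.im h.integral_inner
  rw [← Complex.imCLM_apply, ← ContinuousLinearMap.intervalIntegral_comp_comm _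
    (hc.add hofr)] at h0
  simpa only [map_add, Complex.imCLM_apply, Complex.ofReal_im, Complex.zero_im, add_zero] using h0

theorem inner_equation (hF : ∀ z ∈ Icc 0 l, (α : ℂ) ^ 2 * u₂ z + γ z * u z = F z) {z : ℝ}
    (hz : z ∈ Icc 0 l) : ((α ^ 2 : ℝ) : ℂ) * inner ℂ (u z) (u₂ z) =
      inner ℂ (u z) (F z) - γ z * ((‖u z‖ ^ 2 : ℝ) : ℂ) := by
  rw [← hF z hz, inner_add_right]
  have h1 : inner ℂ (u z) (γ z * u z) = γ z * ((‖u z‖ ^ 2 : ℝ) : ℂ) := by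
    rw [← smul_eq_mul, inner_smul_right, inner_self_eq_norm_sq_to_K]
    push_cast
    rfl
  have h2 : inner ℂ (u z) ((α : ℂ) ^ 2 * u₂ z) = ((α ^ 2 : ℝ) : ℂ) * inner ℂ (u z) (u₂ z) := by
    rw [← smul_eq_mul, inner_smul_right, Complex.ofReal_pow]
  rw [h1, h2]
  ring

/-- The real part of the energy identity for `α² u'' + γ u = F`. -/
theorem energy_re (h : DirichletProfile l u u₁ u₂) (hFc : ContinuousOn F (Icc 0 l))
    (hF : ∀ z ∈ Icc 0 l, (α : ℂ) ^ 2 * u₂ z + γ z * u z = F z)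
    (hΓ : ∀ z ∈ Icc 0 l, (γ z).re ≤ Γ) :
    α ^ 2 * ∫ z in (0 : ℝ)..l, ‖u₁ z‖ ^ 2 ≤
      (Γ + 1 / 2) * (∫ z in (0 : ℝ)..l, ‖u z‖ ^ 2) + 1 / 2 * ∫ z in (0 : ℝ)..l, ‖F z‖ ^ 2 := by
  have hu : IntervalIntegrable (fun z => ‖u z‖ ^ 2) MeasureTheory.volume 0 l :=
    intervalIntegrable_of_continuousOn h.pos.le (h.continuousOn.norm.pow 2)
  have hFi : IntervalIntegrable (fun z => ‖F z‖ ^ 2) MeasureTheory.volume 0 l :=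
    intervalIntegrable_of_continuousOn h.pos.le (hFc.norm.pow 2)
  have hc : IntervalIntegrable (fun z => (inner ℂ (u z) (u₂ z)).re) MeasureTheory.volume 0 l :=
    intervalIntegrable_of_continuousOn h.pos.le
      (Complex.continuous_re.comp_continuousOn h.continuousOn_inner)
  have key := intervalIntegral.integral_mono_on h.pos.le (hc.const_mul (-α ^ 2))
    ((hu.const_mul (Γ + 1 / 2)).add (hFi.const_mul (1 / 2))) fun z hz => by
      have h1 := congrArg Complex.re (inner_equation hF hz)
      rw [Complex.re_ofReal_mul, Complex.sub_re, Complex.re_mul_ofReal] at h1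
      have h2 := (abs_le.1 (Complex.abs_re_le_norm (inner ℂ (u z) (F z)))).1
      have h3 := norm_inner_le_norm (𝕜 := ℂ) (u z) (F z)
      have h4 := mul_le_mul_of_nonneg_right (hΓ z hz) (sq_nonneg ‖u z‖)
      have h5 := sq_nonneg (‖u z‖ - ‖F z‖)
      nlinarith
  rw [intervalIntegral.integral_const_mul, intervalIntegral.integral_add (hu.const_mul _)
    (hFi.const_mul _), intervalIntegral.integral_const_mul,
    intervalIntegral.integral_const_mul] at key
  rw [h.integral_re] at key
  linarith

/-- The imaginary part of the energy identity for `α² u'' + γ u = F`. -/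
theorem energy_im (h : DirichletProfile l u u₁ u₂) (hFc : ContinuousOn F (Icc 0 l))
    (hF : ∀ z ∈ Icc 0 l, (α : ℂ) ^ 2 * u₂ z + γ z * u z = F z) {c σ : ℝ} (hc0 : 0 < c)
    (hσ : |σ| = 1) (hγ : ∀ z ∈ Icc 0 l, c ≤ σ * (γ z).im) :
    ∫ z in (0 : ℝ)..l, ‖u z‖ ^ 2 ≤ (c ^ 2)⁻¹ * ∫ z in (0 : ℝ)..l, ‖F z‖ ^ 2 := by
  have hu : IntervalIntegrable (fun z => ‖u z‖ ^ 2) MeasureTheory.volume 0 l :=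
    intervalIntegrable_of_continuousOn h.pos.le (h.continuousOn.norm.pow 2)
  have hFi : IntervalIntegrable (fun z => ‖F z‖ ^ 2) MeasureTheory.volume 0 l :=
    intervalIntegrable_of_continuousOn h.pos.le (hFc.norm.pow 2)
  have hc : IntervalIntegrable (fun z => (inner ℂ (u z) (u₂ z)).im) MeasureTheory.volume 0 l :=
    intervalIntegrable_of_continuousOn h.pos.le
      (Complex.continuous_im.comp_continuousOn h.continuousOn_inner)
  -- The term in `u₂` cannot be bounded pointwise by `u` and `F`; it is carried along because its
  -- imaginary part integrates to zero.
  have key := intervalIntegral.integral_mono_on h.pos.le hu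
    ((hFi.const_mul (c ^ 2)⁻¹).add (hc.const_mul (-(2 * c⁻¹ * σ * α ^ 2)))) fun z hz => by
      have h1 := congrArg (fun w => σ * Complex.im w) (inner_equation hF hz)
      simp only [Complex.im_ofReal_mul, Complex.sub_im, Complex.im_mul_ofReal] at h1
      have h2 : σ * (inner ℂ (u z) (F z)).im ≤ ‖u z‖ * ‖F z‖ := by
        refine (le_abs_self _).trans ?_
        rw [abs_mul, hσ, one_mul]
        exact (Complex.abs_im_le_norm _).trans (norm_inner_le_norm (𝕜 := ℂ) (u z) (F z))
      have h4 := mul_le_mul_of_nonneg_right (hγ z hz) (sq_nonneg ‖u z‖)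
      have h5 := sq_nonneg (c * ‖u z‖ - ‖F z‖)
      have h6 : c * ‖u z‖ ^ 2 ≤ ‖u z‖ * ‖F z‖ - σ * α ^ 2 * (inner ℂ (u z) (u₂ z)).im := by
        linarith
      rw [← mul_le_mul_iff_right₀ (pow_pos hc0 2)]
      have h7 : c ^ 2 * ((c ^ 2)⁻¹ * ‖F z‖ ^ 2 +
          -(2 * c⁻¹ * σ * α ^ 2) * (inner ℂ (u z) (u₂ z)).im) =
          ‖F z‖ ^ 2 - 2 * c * (σ * α ^ 2 * (inner ℂ (u z) (u₂ z)).im) := by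
        field_simp
        ring
      rw [h7]
      nlinarith
  rw [intervalIntegral.integral_add (hFi.const_mul _) (hc.const_mul _),
    intervalIntegral.integral_const_mul, intervalIntegral.integral_const_mul] at key
  rwa [h.integral_im, mul_zero, add_zero] at key

end DirichletProfile

/-- Used with `m = s 0`: depths below `m` are reached from the initial line and see the data `w`,
larger ones are reached from the bottom and see only the constant. -/
theorem integral_le_of_le_split {m A c : ℝ} {h w : ℝ → ℝ} (hm : 0 ≤ m) (hml : m ≤ l)
    (hh : ContinuousOn h (Icc 0 l)) (hw : ContinuousOn w (Icc 0 m))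
    (h1 : ∀ z ∈ Icc 0 m, h z ≤ A * w z + c) (h2 : ∀ z ∈ Ioc m l, h z ≤ c) :
    ∫ z in (0 : ℝ)..l, h z ≤ A * (∫ z in (0 : ℝ)..m, w z) + c * l := by
  have hi1 := (hh.mono (Icc_subset_Icc_right hml)).intervalIntegrable_of_Icc
    (μ := MeasureTheory.volume) hm
  have hi2 := (hh.mono (Icc_subset_Icc_left hm)).intervalIntegrable_of_Icc
    (μ := MeasureTheory.volume) hml
  have hwi := intervalIntegrable_of_continuousOn hm hw
  rw [← intervalIntegral.integral_add_adjacent_intervals hi1 hi2]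
  have e1 := intervalIntegral.integral_mono_on hm hi1 ((hwi.const_mul A).add (by simp)) h1
  have e2 := intervalIntegral.integral_mono_on_of_le_Ioo hml hi2
    (intervalIntegrable_const (c := c)) fun z hz => h2 z (Ioo_subset_Ioc_self hz)
  rw [intervalIntegral.integral_add (hwi.const_mul A) (by simp),
    intervalIntegral.integral_const_mul] at e1
  simp at e1 e2
  linarith

end Interval

/-! ### Growth in range: a Gronwall estimate and a weighted bootstrap. -/

/-- A Gronwall estimate for `y' = κ y + O(G exp (μ t))`. -/
theorem norm_le_of_norm_deriv_sub_le {κ : ℂ} {y y' : ℝ → ℂ} {a b μ G : ℝ} (ha : 0 ≤ a)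
    (hab : a ≤ b) (hμ : 0 < μ) (hG : 0 ≤ G)
    (hy : ∀ t ∈ Icc a b, HasDerivWithinAt y (y' t) (Icc a b) t)
    (hyG : ∀ t ∈ Icc a b, ‖y' t - κ * y t‖ ≤ G * Real.exp (μ * t)) :
    ‖y b‖ ≤ Real.exp (2 * ‖κ‖ * b) * (‖y a‖ + G * Real.exp (μ * b) / μ) := by
  have hexp : ∀ (κ : ℂ), ∀ t ∈ Icc a b, ‖Complex.exp (κ * t)‖ ≤ Real.exp (‖κ‖ * b) := by
    intro κ t ht
    rw [Complex.norm_exp]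
    refine Real.exp_le_exp.2 ((Complex.re_le_norm _).trans ?_)
    rw [norm_mul, Complex.norm_real, Real.norm_of_nonneg (ha.trans ht.1)]
    gcongr
    exact ht.2
  set L := Real.exp (‖κ‖ * b) with hL
  have hLpos : 0 < L := Real.exp_pos _
  -- Integrating factor `exp (-κ t)`. Inserting and removing it each cost a factor `L`, whence the 2
  -- in the final exponent.
  have hx : ∀ t ∈ Icc a b, HasDerivWithinAt (fun t : ℝ => Complex.exp (-κ * t) * y t)
      (Complex.exp (-κ * t) * (y' t - κ * y t)) (Icc a b) t := by
    intro t ht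
    have h1 : HasDerivAt (fun t : ℝ => Complex.exp (-κ * t))
        (Complex.exp (-κ * t) * (-κ * 1)) t :=
      (((hasDerivAt_id (t : ℂ)).const_mul (-κ)).cexp).comp_ofReal
    refine (h1.hasDerivWithinAt.mul (hy t ht)).congr_deriv ?_
    ring
  have hB : ∀ t : ℝ, HasDerivAt (fun t => L * ‖y a‖ + L * G / μ * Real.exp (μ * t))
      (L * (G * Real.exp (μ * t))) t := by
    intro t
    have := ((((hasDerivAt_id t).const_mul μ).exp).const_mul (L * G / μ)).const_add (L * ‖y a‖)
    refine this.congr_deriv ?_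
    simp only [id]
    field_simp
  have hmain := image_norm_le_of_norm_deriv_right_le_deriv_boundary'
    (fun t ht => (hx t ht).continuousWithinAt)
    (fun t ht => (hx t (Ico_subset_Icc_self ht)).mono_of_mem_nhdsWithin
      (Filter.mem_of_superset (Icc_mem_nhdsGE ht.2) (Icc_subset_Icc_left ht.1)))
    (B := fun t => L * ‖y a‖ + L * G / μ * Real.exp (μ * t)) ?_
    (fun t _ => (hB t).continuousAt.continuousWithinAt)
    (fun t _ => (hB t).hasDerivWithinAt) ?_ (right_mem_Icc.2 hab)
  · have hb : y b = Complex.exp (κ * b) * (Complex.exp (-κ * b) * y b) := by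
      rw [← mul_assoc, ← Complex.exp_add]
      simp
    rw [hb, norm_mul]
    calc _ ≤ L * (L * ‖y a‖ + L * G / μ * Real.exp (μ * b)) :=
          mul_le_mul (hexp κ b (right_mem_Icc.2 hab)) hmain (norm_nonneg _) hLpos.le
      _ = _ := by
          have : Real.exp (2 * ‖κ‖ * b) = L * L := by
            rw [hL, ← Real.exp_add]
            ring_nf
          rw [this]
          ring
  · rw [norm_mul]
    have h1 := mul_le_mul_of_nonneg_right (hexp (-κ) a (left_mem_Icc.2 hab)) (norm_nonneg (y a))
    rw [norm_neg] at h1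
    have : 0 ≤ L * G / μ * Real.exp (μ * a) := by positivity
    linarith
  · intro t ht
    rw [norm_mul]
    have h1 := hexp (-κ) t (Ico_subset_Icc_self ht)
    rw [norm_neg] at h1
    exact mul_le_mul h1 (hyG t (Ico_subset_Icc_self ht)) (norm_nonneg _) hLpos.le

/-- A bounded function `φ` that improves each of its exponential bounds by a factor `1 / 2`, up to
a term `K`, is bounded by `2 K exp (μ t)`. -/
theorem le_two_mul_exp_of_improve {S : Set ℝ} {φ : ℝ → ℝ} {K μ : ℝ} (hS : ∀ t ∈ S, 0 ≤ t)
    (hμ : 0 ≤ μ) (hφ : ∀ t ∈ S, 0 ≤ φ t) (hbdd : ∃ B, ∀ t ∈ S, φ t ≤ B)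
    (himp : ∀ B, 0 ≤ B → (∀ t ∈ S, φ t ≤ B * Real.exp (μ * t)) →
      ∀ t ∈ S, φ t ≤ (K + B / 2) * Real.exp (μ * t)) {t : ℝ} (ht : t ∈ S) :
    φ t ≤ 2 * K * Real.exp (μ * t) := by
  -- With `B` the supremum of `φ t * exp (-μ t)`, finite by `hbdd`, the improvement gives `B ≤ K + B
  -- / 2`, so `B ≤ 2 K`.
  set X := (fun t => φ t * Real.exp (-(μ * t))) '' S with hX
  have hne : X.Nonempty := ⟨_, mem_image_of_mem _ ht⟩
  have hle : ∀ {t B : ℝ}, φ t * Real.exp (-(μ * t)) ≤ B ↔ φ t ≤ B * Real.exp (μ * t) := by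
    intro t B
    rw [Real.exp_neg, ← div_eq_mul_inv, div_le_iff₀ (Real.exp_pos _)]
  have hb : BddAbove X := by
    obtain ⟨B, hB⟩ := hbdd
    refine ⟨B, ?_⟩
    rintro _ ⟨t, ht, rfl⟩
    refine (mul_le_of_le_one_right (hφ t ht) ?_).trans (hB t ht)
    exact Real.exp_le_one_iff.2 (neg_nonpos.2 (mul_nonneg hμ (hS t ht)))
  have hsup : ∀ t ∈ S, φ t ≤ sSup X * Real.exp (μ * t) := fun t ht =>
    hle.1 (le_csSup hb (mem_image_of_mem _ ht))
  have h0 : 0 ≤ sSup X := (mul_nonneg (hφ t ht) (Real.exp_pos _).le).trans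
    (le_csSup hb (mem_image_of_mem _ ht))
  have h1 : sSup X ≤ K + sSup X / 2 := by
    refine csSup_le hne ?_
    rintro _ ⟨t, ht, rfl⟩
    exact hle.2 (himp _ h0 hsup t ht)
  refine (hsup t ht).trans ?_
  gcongr
  linarith

/-! ### Elliptic estimates uniform in range. -/

theorem normL2_nonneg (l : ℝ) (w : ℝ → ℂ) : 0 ≤ normL2 l w := Real.sqrt_nonneg _

theorem normL2_sq {l : ℝ} (hl : 0 ≤ l) (w : ℝ → ℂ) :
    normL2 l w ^ 2 = ∫ z in (0 : ℝ)..l, ‖w z‖ ^ 2 :=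
  Real.sq_sqrt (intervalIntegral.integral_nonneg hl fun _ _ => sq_nonneg _)

theorem normL2_const_mul (l : ℝ) (a : ℂ) (w : ℝ → ℂ) :
    normL2 l (fun z => a * w z) = ‖a‖ * normL2 l w := by
  simp only [normL2, norm_mul, mul_pow, intervalIntegral.integral_const_mul]
  rw [Real.sqrt_mul (sq_nonneg _), Real.sqrt_sq (norm_nonneg _)]

/-- A uniform gradient estimate for the Dirichlet problems `α² u'' + γ (r, ·) u = F` on the depth
intervals `[0, s r]`. -/
def GradientBound (α R : ℝ) (s : ℝ → ℝ) (γ : ℝ × ℝ → ℂ) (C : ℝ) : Prop :=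
  ∀ r ∈ Icc 0 R, ∀ u u₁ u₂ F : ℝ → ℂ, DirichletProfile (s r) u u₁ u₂ →
    ContinuousOn F (Icc 0 (s r)) →
    (∀ z ∈ Icc 0 (s r), (α : ℂ) ^ 2 * u₂ z + γ (r, z) * u z = F z) →
    ∫ z in (0 : ℝ)..s r, ‖u₁ z‖ ^ 2 ≤ C * ∫ z in (0 : ℝ)..s r, ‖F z‖ ^ 2

section Elliptic

variable {α R : ℝ} {s : ℝ → ℝ} {γ : ℝ × ℝ → ℂ}

/-- By compactness the imaginary part of `γ` stays away from zero, so the imaginary energy identity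
bounds `u` in `L²`; the real one then bounds the gradient. The sign `σ` treats both signs at once.
-/
theorem exists_gradientBound_of_im (h : Downsloping R s) (hα : 0 < α)
    (hγ : ContinuousOn γ (domain R s)) {σ : ℝ} (hσ : |σ| = 1)
    (hpos : ∀ x ∈ domain R s, 0 < σ * (γ x).im) : ∃ C, 0 ≤ C ∧ GradientBound α R s γ C := by
  have hne : (domain R s).Nonempty :=
    ⟨(0, 0), ⟨le_rfl, h.pos_R.le⟩, le_rfl, (h.pos 0 ⟨le_rfl, h.pos_R.le⟩).le⟩
  obtain ⟨x, hx, hmin⟩ := h.isCompact_domain.exists_isMinOn hne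
    (continuousOn_const.mul (Complex.continuous_im.comp_continuousOn hγ) :
      ContinuousOn (fun x => σ * (γ x).im) (domain R s))
  obtain ⟨Γ, hΓ⟩ := h.isCompact_domain.exists_bound_of_continuousOn hγ
  have hΓ0 : 0 ≤ Γ := (norm_nonneg _).trans (hΓ x hx)
  set c := σ * (γ x).im
  have hc : 0 < c := hpos x hx
  refine ⟨((Γ + 1 / 2) * (c ^ 2)⁻¹ + 1 / 2) / α ^ 2, by positivity, ?_⟩
  intro r hr u u₁ u₂ F hu hFc hF
  have h1 := hu.energy_re hFc hF (Γ := Γ) fun z hz =>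
    (Complex.re_le_norm _).trans (hΓ _ ⟨hr, hz⟩)
  have h2 := hu.energy_im hFc hF hc hσ fun z hz => hmin (show (r, z) ∈ domain R s from ⟨hr, hz⟩)
  have h3 := mul_le_mul_of_nonneg_left h2 (show 0 ≤ Γ + 1 / 2 by linarith)
  rw [div_mul_eq_mul_div, le_div_iff₀ (by positivity)]
  linarith

/-- In shallow water the Poincaré inequality makes the zero-order term at most half of the gradient
term, which absorbs it. -/
theorem gradientBound_of_re (hα : 0 < α) {M δ : ℝ}
    (hγ : ∀ x ∈ domain R s, |(γ x).re| ≤ M) (hM : (|M| + 1 / 2) * δ ^ 2 ≤ 1 / 2)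
    (hδ : ∀ r ∈ Icc 0 R, s r / α ≤ δ) : GradientBound α R s γ (1 / α ^ 2) := by
  intro r hr u u₁ u₂ F hu hFc hF
  have h1 := hu.energy_re hFc hF (Γ := |M|) fun z hz =>
    (le_abs_self _).trans ((hγ _ ⟨hr, hz⟩).trans (le_abs_self _))
  have h2 := hu.integral_sq_le
  have h3 : s r ^ 2 ≤ δ ^ 2 * α ^ 2 := by
    rw [← mul_pow]
    exact pow_le_pow_left₀ hu.pos.le ((div_le_iff₀ hα).1 (hδ r hr)) 2
  have hI : 0 ≤ ∫ z in (0 : ℝ)..s r, ‖u₁ z‖ ^ 2 :=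
    intervalIntegral.integral_nonneg hu.pos.le fun _ _ => sq_nonneg _
  have h4 : (|M| + 1 / 2) * (∫ z in (0 : ℝ)..s r, ‖u z‖ ^ 2) ≤
      1 / 2 * (α ^ 2 * ∫ z in (0 : ℝ)..s r, ‖u₁ z‖ ^ 2) := by
    calc _ ≤ (|M| + 1 / 2) * ((δ ^ 2 * α ^ 2) * ∫ z in (0 : ℝ)..s r, ‖u₁ z‖ ^ 2) := by
          gcongr
          exact h2.trans (by gcongr)
      _ = ((|M| + 1 / 2) * δ ^ 2) * (α ^ 2 * ∫ z in (0 : ℝ)..s r, ‖u₁ z‖ ^ 2) := by ring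
      _ ≤ _ := by gcongr
  rw [div_mul_eq_mul_div, le_div_iff₀ (by positivity)]
  linarith

/-- The gradient bound controls `u` pointwise, the equation then controls `u₂`, and mean-zero of
`u₁` controls `u₁` by the `L²` norm of `u₂`. Only the bound on `u₂` retains the pointwise value of
`F`; the one on `u₁` must not, being used at bottom points. -/
theorem GradientBound.exists_pointwise {C : ℝ} (hC : GradientBound α R s γ C) (hC0 : 0 ≤ C)
    (h : Downsloping R s) (hα : 0 < α) (hγ : ContinuousOn γ (domain R s)) :
    ∃ K > 0, ∀ r ∈ Icc 0 R, ∀ u u₁ u₂ F : ℝ → ℂ, DirichletProfile (s r) u u₁ u₂ →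
      ContinuousOn F (Icc 0 (s r)) →
      (∀ z ∈ Icc 0 (s r), (α : ℂ) ^ 2 * u₂ z + γ (r, z) * u z = F z) →
      ∀ z ∈ Icc 0 (s r), ‖u z‖ ≤ K * normL2 (s r) F ∧ ‖u₁ z‖ ≤ K * normL2 (s r) F ∧
        ‖u₂ z‖ ≤ K * (normL2 (s r) F + ‖F z‖) := by
  obtain ⟨Γ, hΓ⟩ := h.isCompact_domain.exists_bound_of_continuousOn hγ
  have hR : R ∈ Icc 0 R := ⟨h.pos_R.le, le_rfl⟩
  have hL := h.pos R hR
  have hΓ0 : 0 ≤ Γ := (norm_nonneg _).trans (hΓ (R, 0) ⟨hR, le_rfl, hL.le⟩)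
  set L := s R
  set c := Real.sqrt (L * C)
  have hc : c ^ 2 = L * C := Real.sq_sqrt (mul_nonneg hL.le hC0)
  have hc0 : 0 ≤ c := Real.sqrt_nonneg _
  set d := (1 + Γ * c) / α ^ 2
  have hd : 0 < d := by positivity
  refine ⟨c + d + 2 * d * (L + 1), by positivity, ?_⟩
  intro r hr u u₁ u₂ F hu hFc hF
  set φ := normL2 (s r) F
  have hφ0 : 0 ≤ φ := normL2_nonneg _ _
  have hφ : φ ^ 2 = ∫ z in (0 : ℝ)..s r, ‖F z‖ ^ 2 := normL2_sq hu.pos.le F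
  have hsL : s r ≤ L := h.strictMonoOn.monotoneOn hr hR hr.2
  have hu0 : ∀ z ∈ Icc 0 (s r), ‖u z‖ ≤ c * φ := by
    intro z hz
    refine le_of_sq_le_sq ?_ (by positivity)
    calc ‖u z‖ ^ 2 ≤ s r * ∫ y in (0 : ℝ)..s r, ‖u₁ y‖ ^ 2 := hu.sq_norm_le hz
      _ ≤ L * (C * φ ^ 2) := by
        rw [hφ]
        exact mul_le_mul hsL (hC r hr u u₁ u₂ F hu hFc hF)
          (intervalIntegral.integral_nonneg hu.pos.le fun _ _ => sq_nonneg _) hL.le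
      _ = (c * φ) ^ 2 := by rw [mul_pow, hc]; ring
  have hu2 : ∀ z ∈ Icc 0 (s r), ‖u₂ z‖ ≤ d * (φ + ‖F z‖) := by
    intro z hz
    have h1 : ((α ^ 2 : ℝ) : ℂ) * u₂ z = F z - γ (r, z) * u z := by
      rw [← hF z hz]
      push_cast
      ring
    have h2 : α ^ 2 * ‖u₂ z‖ ≤ ‖F z‖ + Γ * (c * φ) := by
      calc α ^ 2 * ‖u₂ z‖ = ‖((α ^ 2 : ℝ) : ℂ) * u₂ z‖ := by
            rw [norm_mul, Complex.norm_real, Real.norm_of_nonneg (sq_nonneg α)]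
        _ ≤ ‖F z‖ + ‖γ (r, z)‖ * ‖u z‖ := by
            rw [h1, ← norm_mul]
            exact norm_sub_le _ _
        _ ≤ _ := by
            gcongr
            · exact hΓ _ ⟨hr, hz⟩
            · exact hu0 z hz
    have h3 : d * (φ + ‖F z‖) = (1 + Γ * c) * (φ + ‖F z‖) / α ^ 2 := by ring
    rw [h3, le_div_iff₀ (by positivity)]
    nlinarith [mul_nonneg (mul_nonneg hΓ0 hc0) (norm_nonneg (F z))]
  have hu1 : ∀ z ∈ Icc 0 (s r), ‖u₁ z‖ ≤ 2 * d * (L + 1) * φ := by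
    intro z hz
    refine le_of_sq_le_sq ?_ (by positivity)
    have hi : IntervalIntegrable (fun z => ‖u₂ z‖ ^ 2) MeasureTheory.volume 0 (s r) :=
      intervalIntegrable_of_continuousOn hu.pos.le (hu.continuousOn₂.norm.pow 2)
    have hiF : IntervalIntegrable (fun z => ‖F z‖ ^ 2) MeasureTheory.volume 0 (s r) :=
      intervalIntegrable_of_continuousOn hu.pos.le (hFc.norm.pow 2)
    have h1 : ∫ y in (0 : ℝ)..s r, ‖u₂ y‖ ^ 2 ≤ 2 * d ^ 2 * (φ ^ 2 + s r * φ ^ 2) := by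
      have := intervalIntegral.integral_mono_on hu.pos.le hi
        ((hiF.const_mul (2 * d ^ 2)).add
          (intervalIntegrable_const (c := 2 * d ^ 2 * φ ^ 2))) fun y hy => by
          have h1 := pow_le_pow_left₀ (norm_nonneg _) (hu2 y hy) 2
          have h2 : (φ + ‖F y‖) ^ 2 ≤ 2 * (φ ^ 2 + ‖F y‖ ^ 2) := add_sq_le
          rw [mul_pow] at h1
          nlinarith [mul_le_mul_of_nonneg_left h2 (sq_nonneg d)]
      rw [intervalIntegral.integral_add (hiF.const_mul _) intervalIntegrable_const,
        intervalIntegral.integral_const_mul, ← hφ] at this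
      simp only [intervalIntegral.integral_const, sub_zero, smul_eq_mul] at this
      linarith
    calc ‖u₁ z‖ ^ 2 ≤ s r * ∫ y in (0 : ℝ)..s r, ‖u₂ y‖ ^ 2 := hu.sq_norm_deriv_le hz
      _ ≤ L * (2 * d ^ 2 * (φ ^ 2 + L * φ ^ 2)) := by
        refine mul_le_mul hsL (h1.trans (by gcongr))
          (intervalIntegral.integral_nonneg hu.pos.le fun _ _ => sq_nonneg _) hL.le
      _ ≤ (2 * d * (L + 1) * φ) ^ 2 := by
        have : 0 ≤ d ^ 2 * φ ^ 2 := by positivity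
        nlinarith [mul_nonneg this hL.le, mul_nonneg this (sq_nonneg L)]
  intro z hz
  have hL1 : 0 ≤ 2 * d * (L + 1) := by positivity
  refine ⟨(hu0 z hz).trans ?_, (hu1 z hz).trans ?_, (hu2 z hz).trans ?_⟩ <;> gcongr <;> linarith

end Elliptic

/-! ### The defect of a solution and its boundary values. -/

/-- The growth rate `i λ / q` of the operator equation `v_r = (i λ / q) v + u`. -/
noncomputable def rate (α : ℝ) (p q : ℂ) : ℂ := Complex.I * lam α p q / q

/-- The deviation `∂_r f - (i λ / q) f` of `f` from exponential growth in range. -/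
noncomputable def defect (α : ℝ) (p q : ℂ) (D : Set (ℝ × ℝ)) (f : ℝ × ℝ → ℂ) (x : ℝ × ℝ) : ℂ :=
  dr D f x - rate α p q * f x

namespace IsSolution

variable {α R : ℝ} {p q : ℂ} {s : ℝ → ℝ} {β : ℝ × ℝ → ℂ} {v₀ : ℝ → ℂ} {v : ℝ × ℝ → ℂ}

theorem smooth₁ (hv : IsSolution α p q R s β v₀ v) (h : Downsloping R s) :
    ContDiffOn ℝ 2 (dz (domain R s) v) (domain R s) :=
  contDiffOn_dz h hv.smooth (by norm_num)

theorem smooth₂ (hv : IsSolution α p q R s β v₀ v) (h : Downsloping R s) :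
    ContDiffOn ℝ 1 (dz (domain R s) (dz (domain R s) v)) (domain R s) :=
  contDiffOn_dz h (hv.smooth₁ h) (by norm_num)

theorem dz_bottom (hv : IsSolution α p q R s β v₀ v) (h : Downsloping R s) {r : ℝ}
    (hr : r ∈ Icc 0 R) : dz (domain R s) v (r, s r) = 0 := by
  have := dr_add_smul_dz_bottom h (hv.smooth.differentiableOn (by norm_num)) hv.bottom hr
  rw [hv.bottom_dr r hr, zero_add] at this
  exact (smul_eq_zero.1 this).resolve_left (h.deriv_pos r hr).ne'

/-- As `v_z` vanishes along the bottom, so does its tangential derivative, and there the defect of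
`v_z` is just its range derivative. -/
theorem deriv_smul_dz_dz_bottom (hv : IsSolution α p q R s β v₀ v) (h : Downsloping R s) {r : ℝ}
    (hr : r ∈ Icc 0 R) :
    derivWithin s (Icc 0 R) r • dz (domain R s) (dz (domain R s) v) (r, s r) =
      -defect α p q (domain R s) (dz (domain R s) v) (r, s r) := by
  have := dr_add_smul_dz_bottom h ((hv.smooth₁ h).differentiableOn (by norm_num))
    (fun t ht => hv.dz_bottom h ht) hr
  rw [defect, hv.dz_bottom h hr, mul_zero, sub_zero]
  exact eq_neg_of_add_eq_zero_right this

/-- The rate is constant and mixed derivatives commute, so taking the defect commutes with `∂_z`. -/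
theorem dirichletProfile (hv : IsSolution α p q R s β v₀ v) (h : Downsloping R s) {r : ℝ}
    (hr : r ∈ Icc 0 R) :
    DirichletProfile (s r) (fun z => defect α p q (domain R s) v (r, z))
      (fun z => defect α p q (domain R s) (dz (domain R s) v) (r, z))
      (fun z => defect α p q (domain R s) (dz (domain R s) (dz (domain R s) v)) (r, z)) := by
  have hd0 := hv.smooth.differentiableOn (by norm_num)
  have hd1 := (hv.smooth₁ h).differentiableOn (by norm_num)
  have hg0 := (contDiffOn_dr h hv.smooth (m := 1) (by norm_num)).differentiableOn (by norm_num)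
  have hg1 := (contDiffOn_dr h (hv.smooth₁ h) (m := 1) (by norm_num)).differentiableOn
    (by norm_num)
  refine ⟨h.pos r hr, fun z hz => ?_, fun z hz => ?_, ?_, ?_, ?_⟩
  · have hx : (r, z) ∈ domain R s := ⟨hr, hz⟩
    have := (hasDerivWithinAt_depth hg0 hx).sub
      ((hasDerivWithinAt_depth hd0 hx).const_mul (rate α p q))
    rwa [dz_dr_comm h (hv.smooth.of_le (by norm_num)) hx] at this
  · have hx : (r, z) ∈ domain R s := ⟨hr, hz⟩
    have := (hasDerivWithinAt_depth hg1 hx).sub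
      ((hasDerivWithinAt_depth hd1 hx).const_mul (rate α p q))
    rwa [dz_dr_comm h (hv.smooth₁ h) hx] at this
  · have hc : ContinuousOn (defect α p q (domain R s) (dz (domain R s) (dz (domain R s) v)))
        (domain R s) :=
      (contDiffOn_dr h (hv.smooth₂ h) (m := 0) (by norm_num)).continuousOn.sub
        (continuousOn_const.mul (hv.smooth₂ h).continuousOn)
    exact hc.comp (by fun_prop) fun z hz => ⟨hr, hz⟩
  · simp [defect, dr_surface h hd0 hv.surface hr, hv.surface r hr]
  · simp [defect, hv.bottom_dr r hr, hv.bottom r hr]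

/-- The right side contains no derivative of `v`, so the elliptic estimate loses none. -/
theorem defect_equation (hv : IsSolution α p q R s β v₀ v) (hq : q ≠ 0) {x : ℝ × ℝ}
    (hx : x ∈ domain R s) :
    (α : ℂ) ^ 2 * defect α p q (domain R s) (dz (domain R s) (dz (domain R s) v)) x +
      (q⁻¹ + β x) * defect α p q (domain R s) v x = -(rate α p q / q) * v x := by
  have := hv.equation x hx
  simp only [defect, rate]
  field_simp
  linear_combination q * this

theorem continuousOn_slice {f : ℝ × ℝ → ℂ} (hf : ContinuousOn f (domain R s)) {r : ℝ}
    (hr : r ∈ Icc 0 R) : ContinuousOn (fun z => f (r, z)) (Icc 0 (s r)) :=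
  hf.comp (by fun_prop) fun _ hz => ⟨hr, hz⟩

end IsSolution

/-- Pointwise bounds of the defects of `v`, `v_z`, `v_zz` by the `L²` norm of `v` on the same depth
interval. -/
def DefectBound (α : ℝ) (p q : ℂ) (R : ℝ) (s : ℝ → ℝ) (β : ℝ × ℝ → ℂ) (K : ℝ) : Prop :=
  ∀ (v₀ : ℝ → ℂ) (v : ℝ × ℝ → ℂ), IsSolution α p q R s β v₀ v →
    ∀ r ∈ Icc 0 R, ∀ z ∈ Icc 0 (s r),
      ‖defect α p q (domain R s) v (r, z)‖ ≤ K * normL2 (s r) (fun z => v (r, z)) ∧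
      ‖defect α p q (domain R s) (dz (domain R s) v) (r, z)‖ ≤
        K * normL2 (s r) (fun z => v (r, z)) ∧
      ‖defect α p q (domain R s) (dz (domain R s) (dz (domain R s) v)) (r, z)‖ ≤
        K * (normL2 (s r) (fun z => v (r, z)) + ‖v (r, z)‖)

/-! ### Stability in `L²`. -/

section Stability

variable {α R : ℝ} {p q : ℂ} {s : ℝ → ℝ} {β : ℝ × ℝ → ℂ}

theorem exists_defectBound (h : Downsloping R s) (hα : 0 < α) (hq : q ≠ 0)
    (hβ : ContinuousOn β (domain R s)) {C : ℝ} (hC0 : 0 ≤ C)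
    (hC : GradientBound α R s (fun x => q⁻¹ + β x) C) :
    ∃ K > 0, DefectBound α p q R s β K := by
  obtain ⟨K, hK, hb⟩ := hC.exists_pointwise hC0 h hα (continuousOn_const.add hβ)
  refine ⟨K * (‖rate α p q / q‖ + 1), by positivity, ?_⟩
  intro v₀ v hv r hr z hz
  obtain ⟨h0, h1, h2⟩ := hb r hr _ _ _ (fun z => -(rate α p q / q) * v (r, z))
    (hv.dirichletProfile h hr)
    (continuousOn_const.mul (IsSolution.continuousOn_slice hv.smooth.continuousOn hr))
    (fun z hz => hv.defect_equation hq ⟨hr, hz⟩) z hz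
  rw [normL2_const_mul, norm_neg] at h0 h1 h2
  rw [norm_mul, norm_neg, ← mul_add] at h2
  have hφ := normL2_nonneg (s r) (fun z => v (r, z))
  refine ⟨h0.trans ?_, h1.trans ?_, h2.trans ?_⟩ <;> rw [mul_assoc] <;> gcongr <;> linarith

theorem norm_le_of_defect_le {f : ℝ × ℝ → ℂ} (hf : DifferentiableOn ℝ f (domain R s))
    {a r z μ G : ℝ} (ha : a ∈ Icc 0 r) (hr : r ≤ R) (hseg : ∀ t ∈ Icc a r, (t, z) ∈ domain R s)
    (hμ : 0 < μ) (hG : 0 ≤ G)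
    (hfG : ∀ t ∈ Icc a r, ‖defect α p q (domain R s) f (t, z)‖ ≤ G * Real.exp (μ * t)) :
    ‖f (r, z)‖ ≤
      Real.exp (2 * ‖rate α p q‖ * R) * (‖f (a, z)‖ + G * Real.exp (μ * r) / μ) := by
  refine (norm_le_of_norm_deriv_sub_le ha.1 ha.2 hμ hG
    (fun t ht => hasDerivWithinAt_range hf hseg ht) hfG).trans ?_
  gcongr

theorem DefectBound.exists_normL2_le {K : ℝ} (hK : DefectBound α p q R s β K) (hK0 : 0 < K)
    (h : Downsloping R s) :
    ∃ C > 0, ∀ (v₀ : ℝ → ℂ) (v : ℝ × ℝ → ℂ), IsSolution α p q R s β v₀ v → ∀ r ∈ Icc 0 R,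
      normL2 (s r) (fun z => v (r, z)) ≤ C * normL2 (s 0) (fun z => v (0, z)) := by
  have hR : R ∈ Icc 0 R := ⟨h.pos_R.le, le_rfl⟩
  have h0R : (0 : ℝ) ∈ Icc 0 R := ⟨le_rfl, h.pos_R.le⟩
  have hL := h.pos R hR
  set L := s R
  set E := Real.exp (2 * ‖rate α p q‖ * R)
  have hE : 0 < E := Real.exp_pos _
  -- This makes `E * K / μ = 1 / (4 (L + 1))`, small enough that the assumed bound `B` returns as at
  -- most `B / 2` after integration over a depth of at most `L`.
  set μ := 4 * E * K * (L + 1) with hμdef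
  have hμ : 0 < μ := by positivity
  refine ⟨4 * E * Real.exp (μ * R), by positivity, fun v₀ v hv r hr => ?_⟩
  have hd := hv.smooth.differentiableOn (by norm_num)
  have hc := hv.smooth.continuousOn
  set φ := fun r => normL2 (s r) (fun z => v (r, z)) with hφ
  have hφ0 : ∀ r, 0 ≤ φ r := fun r => normL2_nonneg _ _
  have hφsq : ∀ r ∈ Icc 0 R, φ r ^ 2 = ∫ z in (0 : ℝ)..s r, ‖v (r, z)‖ ^ 2 :=
    fun r hr => normL2_sq (h.pos r hr).le _
  have hci : ∀ r ∈ Icc 0 R, ContinuousOn (fun z => ‖v (r, z)‖ ^ 2) (Icc 0 (s r)) :=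
    fun r hr => (IsSolution.continuousOn_slice hc hr).norm.pow 2
  have hsL : ∀ r ∈ Icc 0 R, s r ≤ L := fun r hr => h.strictMonoOn.monotoneOn hr hR hr.2
  -- This bound depends on `v`; it only makes the weighted supremum finite and does not enter the
  -- constant.
  have hbdd : ∃ B, ∀ r ∈ Icc 0 R, φ r ≤ B := by
    obtain ⟨b, hb⟩ := h.isCompact_domain.exists_bound_of_continuousOn hc
    refine ⟨Real.sqrt (b ^ 2 * L), fun r hr => Real.le_sqrt_of_sq_le ?_⟩
    rw [hφsq r hr]
    have := intervalIntegral.integral_mono_on (h.pos r hr).le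
      (intervalIntegrable_of_continuousOn (h.pos r hr).le (hci r hr))
      (intervalIntegrable_const (c := b ^ 2))
      fun z hz => pow_le_pow_left₀ (norm_nonneg _) (hb (r, z) ⟨hr, hz⟩) 2
    simp only [intervalIntegral.integral_const, sub_zero, smul_eq_mul] at this
    rw [mul_comm]
    exact this.trans (mul_le_mul_of_nonneg_right (hsL r hr) (sq_nonneg b))
  have himp : ∀ B, 0 ≤ B → (∀ t ∈ Icc 0 R, φ t ≤ B * Real.exp (μ * t)) →
      ∀ t ∈ Icc 0 R, φ t ≤ (2 * E * φ 0 + B / 2) * Real.exp (μ * t) := by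
    intro B hB hφB r hr
    have hpt : ∀ z ∈ Icc 0 (s r), ∃ a ∈ Icc 0 r,
        ((a = 0 ∧ z ≤ s 0) ∨ (z = s a ∧ s 0 < z)) ∧
        ‖v (r, z)‖ ^ 2 ≤ 2 * E ^ 2 * ‖v (a, z)‖ ^ 2 +
          2 * (E * K * B * Real.exp (μ * r) / μ) ^ 2 := by
      intro z hz
      obtain ⟨a, ha, hseg, hcase⟩ := h.exists_entry (show (r, z) ∈ domain R s from ⟨hr, hz⟩)
      refine ⟨a, ha, hcase, ?_⟩
      have h1 := norm_le_of_defect_le (α := α) (p := p) (q := q) (G := K * B) hd ha hr.2 hseg hμ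
        (by positivity) fun t ht => by
          obtain ⟨ht', hz'⟩ := hseg t ht
          refine ((hK v₀ v hv t ht' z hz').1).trans ?_
          rw [mul_assoc]
          exact mul_le_mul_of_nonneg_left (hφB t ht') hK0.le
      refine (pow_le_pow_left₀ (norm_nonneg _) h1 2).trans ?_
      have h2 : E * (‖v (a, z)‖ + K * B * Real.exp (μ * r) / μ) =
        E * ‖v (a, z)‖ + E * K * B * Real.exp (μ * r) / μ := by ring
      rw [h2]
      refine add_sq_le.trans_eq ?_
      ring
    have hint := integral_le_of_le_split (h.pos 0 h0R).le
      (h.strictMonoOn.monotoneOn h0R hr hr.1) (hci r hr) (hci 0 h0R) (A := 2 * E ^ 2)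
      (c := 2 * (E * K * B * Real.exp (μ * r) / μ) ^ 2) ?_ ?_
    · rw [← hφsq r hr, ← hφsq 0 h0R] at hint
      refine le_of_sq_le_sq ?_ (mul_nonneg (by have := hφ0 0; positivity) (Real.exp_pos _).le)
      have he : 1 ≤ Real.exp (μ * r) := Real.one_le_exp (mul_nonneg hμ.le hr.1)
      have h3 : 2 * (E * K * B * Real.exp (μ * r) / μ) ^ 2 * s r ≤
          (B / 2 * Real.exp (μ * r)) ^ 2 := by
        have h4 : E * K * B * Real.exp (μ * r) / μ =
            B * Real.exp (μ * r) / (4 * (L + 1)) := by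
          rw [hμdef]
          field_simp
        rw [h4, div_pow, mul_div_assoc', div_mul_eq_mul_div, div_le_iff₀ (by positivity)]
        have h5 : s r ≤ 2 * (L + 1) ^ 2 := by nlinarith [hsL r hr]
        have h6 := mul_le_mul_of_nonneg_left h5 (sq_nonneg (B * Real.exp (μ * r)))
        linarith
      have h7 : 2 * E ^ 2 * φ 0 ^ 2 ≤ (2 * E * φ 0 * Real.exp (μ * r)) ^ 2 := by
        rw [mul_pow, mul_pow, mul_pow]
        have : 1 ≤ Real.exp (μ * r) ^ 2 := one_le_pow₀ he
        nlinarith [mul_nonneg (sq_nonneg E) (sq_nonneg (φ 0))]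
      have h8 : 0 ≤ (2 * E * φ 0 * Real.exp (μ * r)) * (B / 2 * Real.exp (μ * r)) := by
        have := hφ0 0
        positivity
      rw [add_mul]
      nlinarith
    · intro z hz
      obtain ⟨a, -, hcase, hb⟩ := hpt z ⟨hz.1, hz.2.trans (h.strictMonoOn.monotoneOn h0R hr hr.1)⟩
      rcases hcase with ⟨rfl, -⟩ | ⟨-, hlt⟩
      · exact hb
      · exact absurd hz.2 hlt.not_ge
    · intro z hz
      obtain ⟨a, ha, hcase, hb⟩ := hpt z ⟨(h.pos 0 h0R).le.trans hz.1.le, hz.2⟩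
      rcases hcase with ⟨-, hle⟩ | ⟨rfl, -⟩
      · exact absurd hz.1 hle.not_gt
      · rw [hv.bottom a ⟨ha.1, ha.2.trans hr.2⟩] at hb
        simpa using hb
  have := le_two_mul_exp_of_improve (fun t ht => ht.1) hμ.le (fun t _ => hφ0 t) hbdd himp hr
  refine this.trans ?_
  have hmono : Real.exp (μ * r) ≤ Real.exp (μ * R) :=
    Real.exp_le_exp.2 (mul_le_mul_of_nonneg_left hr.2 hμ.le)
  calc 2 * (2 * E * φ 0) * Real.exp (μ * r) ≤ 2 * (2 * E * φ 0) * Real.exp (μ * R) := by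
        have := hφ0 0
        gcongr
    _ = _ := by ring

end Stability

/-! ### Sobolev norms expressed through given derivatives. -/

section Norms

variable {l : ℝ} {w w' : ℝ → ℂ}

theorem normL2_congr (hl : 0 ≤ l) (h : EqOn w w' (Icc 0 l)) : normL2 l w = normL2 l w' := by
  unfold normL2
  congr 1
  refine intervalIntegral.integral_congr fun z hz => ?_
  rw [uIcc_of_le hl] at hz
  simp only [h hz]

theorem normH1_congr (hl : 0 ≤ l) (h : EqOn w w' (Icc 0 l)) : normH1 l w = normH1 l w' := by
  unfold normH1
  rw [normL2_congr hl h, normL2_congr hl fun z hz => derivWithin_congr h (h hz)]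

theorem normH2_congr (hl : 0 ≤ l) (h : EqOn w w' (Icc 0 l)) : normH2 l w = normH2 l w' := by
  unfold normH2
  rw [normH1_congr hl h, normL2_congr hl (iteratedDerivWithin_congr h)]

theorem normH1_eq {w₁ : ℝ → ℂ} (hl : 0 < l)
    (h : ∀ z ∈ Icc 0 l, HasDerivWithinAt w (w₁ z) (Icc 0 l) z) :
    normH1 l w = Real.sqrt (normL2 l w ^ 2 + normL2 l w₁ ^ 2) := by
  unfold normH1
  rw [normL2_congr hl.le fun z hz => (h z hz).derivWithin (uniqueDiffOn_Icc hl z hz)]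

theorem normH2_eq {w₁ w₂ : ℝ → ℂ} (hl : 0 < l)
    (h : ∀ z ∈ Icc 0 l, HasDerivWithinAt w (w₁ z) (Icc 0 l) z)
    (h₁ : ∀ z ∈ Icc 0 l, HasDerivWithinAt w₁ (w₂ z) (Icc 0 l) z) :
    normH2 l w = Real.sqrt (normL2 l w ^ 2 + normL2 l w₁ ^ 2 + normL2 l w₂ ^ 2) := by
  have hu := uniqueDiffOn_Icc hl
  have he : EqOn (iteratedDerivWithin 2 w (Icc 0 l)) w₂ (Icc 0 l) := by
    intro z hz
    rw [iteratedDerivWithin_succ, iteratedDerivWithin_one]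
    have h' : EqOn (derivWithin w (Icc 0 l)) w₁ (Icc 0 l) :=
      fun y hy => (h y hy).derivWithin (hu y hy)
    rw [derivWithin_congr h' (h' hz), (h₁ z hz).derivWithin (hu z hz)]
  unfold normH2
  rw [normH1_eq hl h, Real.sq_sqrt (by positivity), normL2_congr hl.le he]

end Norms

/-! ### Stability of the depth derivatives. -/

section Stability

variable {α R : ℝ} {p q : ℂ} {s : ℝ → ℝ} {β : ℝ × ℝ → ℂ}

/-- Here `f` is `v_z` or `v_zz` and `g` is `v`. The pointwise value of `g` is allowed because the
defect of `v_zz` is bounded in terms of `‖v‖` at the same point. -/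
theorem sq_normL2_le_of_pointwise (h : Downsloping R s) {f g : ℝ × ℝ → ℂ}
    (hf : ContinuousOn f (domain R s)) (hg : ContinuousOn g (domain R s)) {A : ℝ}
    {r : ℝ} (hr : r ∈ Icc 0 R)
    (h1 : ∀ z ∈ Icc 0 (s r), z ≤ s 0 → ‖f (r, z)‖ ≤
      A * (‖f (0, z)‖ + ‖g (0, z)‖ + normL2 (s 0) (fun z => g (0, z))))
    (h2 : ∀ z ∈ Icc 0 (s r), s 0 < z → ‖f (r, z)‖ ≤ A * normL2 (s 0) (fun z => g (0, z))) :
    normL2 (s r) (fun z => f (r, z)) ^ 2 ≤ 3 * A ^ 2 * (1 + s R) *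
      (normL2 (s 0) (fun z => f (0, z)) ^ 2 + normL2 (s 0) (fun z => g (0, z)) ^ 2) := by
  have hR : R ∈ Icc 0 R := ⟨h.pos_R.le, le_rfl⟩
  have h0R : (0 : ℝ) ∈ Icc 0 R := ⟨le_rfl, h.pos_R.le⟩
  have h0r := h.strictMonoOn.monotoneOn h0R hr hr.1
  have hrR := h.strictMonoOn.monotoneOn hr hR hr.2
  have hf0 := (IsSolution.continuousOn_slice hf h0R).norm.pow 2
  have hg0 := (IsSolution.continuousOn_slice hg h0R).norm.pow 2
  have hs0 := (h.pos 0 h0R).le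
  set φ := normL2 (s 0) (fun z => g (0, z)) with hφ
  have hint := integral_le_of_le_split (A := 3 * A ^ 2) (c := 3 * A ^ 2 * φ ^ 2) hs0 h0r
    ((IsSolution.continuousOn_slice hf hr).norm.pow 2) (hf0.add hg0) (fun z hz => by
      have e1 := pow_le_pow_left₀ (norm_nonneg _) (h1 z ⟨hz.1, hz.2.trans h0r⟩ hz.2) 2
      have e2 : (‖f (0, z)‖ + ‖g (0, z)‖ + φ) ^ 2 ≤
          3 * (‖f (0, z)‖ ^ 2 + ‖g (0, z)‖ ^ 2 + φ ^ 2) := by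
        nlinarith [sq_nonneg (‖f (0, z)‖ - ‖g (0, z)‖), sq_nonneg (‖f (0, z)‖ - φ),
          sq_nonneg (‖g (0, z)‖ - φ)]
      have e3 := mul_le_mul_of_nonneg_left e2 (sq_nonneg A)
      rw [mul_pow] at e1
      simp only [Pi.add_apply, Pi.pow_apply]
      linarith) fun z hz => by
      have e1 := pow_le_pow_left₀ (norm_nonneg _) (h2 z ⟨hs0.trans hz.1.le, hz.2⟩ hz.1) 2
      have e3 : 0 ≤ A ^ 2 * φ ^ 2 := by positivity
      rw [mul_pow] at e1
      simp only [Pi.pow_apply]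
      linarith
  have hsplit : ∫ z in (0 : ℝ)..s 0, (‖f (0, z)‖ ^ 2 + ‖g (0, z)‖ ^ 2) =
      normL2 (s 0) (fun z => f (0, z)) ^ 2 + φ ^ 2 := by
    rw [normL2_sq hs0, hφ, normL2_sq hs0]
    exact intervalIntegral.integral_add (intervalIntegrable_of_continuousOn hs0 hf0)
      (intervalIntegrable_of_continuousOn hs0 hg0)
  simp only [Pi.add_apply, Pi.pow_apply] at hint
  rw [hsplit] at hint
  rw [normL2_sq (h.pos r hr).le]
  refine hint.trans ?_
  have hA := sq_nonneg A
  have e1 : 3 * A ^ 2 * φ ^ 2 * s r ≤ 3 * A ^ 2 * φ ^ 2 * s R := by gcongr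
  have e2 : 0 ≤ 3 * A ^ 2 * s R * normL2 (s 0) (fun z => f (0, z)) ^ 2 := by
    have := (h.pos R hR).le
    positivity
  linarith

/-- With the `L²` estimate available, the defects are controlled by the data and no bootstrap is
needed: the weight exponent `μ = 1` is arbitrary. For `v_zz` the defect also involves `v` itself,
which is first bounded along the same segment. -/
theorem DefectBound.exists_normL2_dz_le {K : ℝ} (hK : DefectBound α p q R s β K) (hK0 : 0 < K)
    (h : Downsloping R s) :
    ∃ C > 0, ∀ (v₀ : ℝ → ℂ) (v : ℝ × ℝ → ℂ), IsSolution α p q R s β v₀ v → ∀ r ∈ Icc 0 R,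
      normL2 (s r) (fun z => dz (domain R s) v (r, z)) ^ 2 ≤
        C * (normL2 (s 0) (fun z => dz (domain R s) v (0, z)) ^ 2 +
          normL2 (s 0) (fun z => v (0, z)) ^ 2) ∧
      normL2 (s r) (fun z => dz (domain R s) (dz (domain R s) v) (r, z)) ^ 2 ≤
        C * (normL2 (s 0) (fun z => dz (domain R s) (dz (domain R s) v) (0, z)) ^ 2 +
          normL2 (s 0) (fun z => v (0, z)) ^ 2) := by
  obtain ⟨C, hC0, hC⟩ := hK.exists_normL2_le hK0 h
  obtain ⟨c, hc0, hc⟩ := h.exists_le_deriv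
  have hL := h.pos R ⟨h.pos_R.le, le_rfl⟩
  set E := Real.exp (2 * ‖rate α p q‖ * R)
  have hE : 0 < E := Real.exp_pos _
  set X := Real.exp R
  have hX : 0 < X := Real.exp_pos _
  -- One constant dominating every coefficient that arises below, as the expansion `hAe` shows; the
  -- term with `c` comes from `v_zz` on the bottom.
  set A := E * (1 + K * C / c + K * C * X + K * (C + E + E * (K * C * X)) * X)
  have hA : 0 < A := by positivity
  refine ⟨3 * A ^ 2 * (1 + s R), by positivity, fun v₀ v hv r hr => ?_⟩
  set φ := normL2 (s 0) (fun z => v (0, z)) with hφdef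
  have hφ : 0 ≤ φ := normL2_nonneg _ _
  have hd := hv.smooth.differentiableOn (by norm_num)
  have hd1 := (hv.smooth₁ h).differentiableOn (by norm_num)
  have hd2 := (hv.smooth₂ h).differentiableOn (by norm_num)
  have hexp : ∀ {t : ℝ}, 0 ≤ t → ∀ {G : ℝ}, 0 ≤ G → G ≤ G * Real.exp (1 * t) := fun ht _ hG =>
    le_mul_of_one_le_right hG (Real.one_le_exp (by simpa using ht))
  have hX' : ∀ {t : ℝ}, t ≤ R → ∀ {G : ℝ}, 0 ≤ G → G * Real.exp (1 * t) / 1 ≤ G * X := by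
    intro t ht G hG
    rw [one_mul, div_one]
    exact mul_le_mul_of_nonneg_left (Real.exp_le_exp.2 ht) hG
  have hKC : ∀ t ∈ Icc 0 R, K * normL2 (s t) (fun z => v (t, z)) ≤ K * C * φ := fun t ht => by
    rw [mul_assoc]
    exact mul_le_mul_of_nonneg_left (hC v₀ v hv t ht) hK0.le
  have hKCφ : 0 ≤ K * C * φ := by positivity
  have hv0 : ∀ {a r z : ℝ}, a ∈ Icc 0 r → r ≤ R → (∀ t ∈ Icc a r, (t, z) ∈ domain R s) →
      ‖v (r, z)‖ ≤ E * (‖v (a, z)‖ + K * C * φ * X) := by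
    intro a r z ha hr hseg
    refine (norm_le_of_defect_le (α := α) (p := p) (q := q) hd ha hr hseg one_pos hKCφ
      fun t ht => ?_).trans ?_
    · obtain ⟨ht', hz'⟩ := hseg t ht
      exact (((hK v₀ v hv t ht' _ hz').1).trans (hKC t ht')).trans (hexp ht'.1 hKCφ)
    · gcongr
      exact hX' hr hKCφ
  have hv1 : ∀ {a r z : ℝ}, a ∈ Icc 0 r → r ≤ R → (∀ t ∈ Icc a r, (t, z) ∈ domain R s) →
      ‖dz (domain R s) v (r, z)‖ ≤ E * (‖dz (domain R s) v (a, z)‖ + K * C * φ * X) := by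
    intro a r z ha hr hseg
    refine (norm_le_of_defect_le (α := α) (p := p) (q := q) hd1 ha hr hseg one_pos hKCφ
      fun t ht => ?_).trans ?_
    · obtain ⟨ht', hz'⟩ := hseg t ht
      exact (((hK v₀ v hv t ht' _ hz').2.1).trans (hKC t ht')).trans (hexp ht'.1 hKCφ)
    · gcongr
      exact hX' hr hKCφ
  have hv2 : ∀ {a r z : ℝ}, a ∈ Icc 0 r → r ≤ R → (∀ t ∈ Icc a r, (t, z) ∈ domain R s) →
      ‖dz (domain R s) (dz (domain R s) v) (r, z)‖ ≤
        E * (‖dz (domain R s) (dz (domain R s) v) (a, z)‖ +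
          (K * (C * φ + E * (‖v (a, z)‖ + K * C * φ * X))) * X) := by
    intro a r z ha hr hseg
    have hG : 0 ≤ K * (C * φ + E * (‖v (a, z)‖ + K * C * φ * X)) := by positivity
    refine (norm_le_of_defect_le (α := α) (p := p) (q := q) hd2 ha hr hseg one_pos hG
      fun t ht => ?_).trans ?_
    · obtain ⟨ht', hz'⟩ := hseg t ht
      refine (((hK v₀ v hv t ht' _ hz').2.2).trans ?_).trans (hexp ht'.1 hG)
      gcongr
      · exact hC v₀ v hv t ht'
      · exact hv0 ⟨ha.1, ht.1⟩ (ht.2.trans hr) fun y hy => hseg y ⟨hy.1, hy.2.trans ht.2⟩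
    · gcongr
      exact hX' hr hG
  have hp1 : 0 ≤ E * (K * C / c) := by positivity
  have hp2 : 0 ≤ E * (K * C * X) := by positivity
  have hp3 : 0 ≤ E * (K * E * X) := by positivity
  have hp4 : 0 ≤ E * (K * (E * (K * C * X)) * X) := by positivity
  have hAe : A = E + E * (K * C / c) + E * (K * C * X) + E * (K * C * X) + E * (K * E * X) +
      E * (K * (E * (K * C * X)) * X) := by ring
  constructor
  · refine sq_normL2_le_of_pointwise h (hv.smooth₁ h).continuousOn hv.smooth.continuousOn hr
      (fun z hz hz0 => ?_) fun z hz hz0 => ?_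
    · obtain ⟨a, ha, hseg, ⟨rfl, -⟩ | ⟨-, hlt⟩⟩ :=
        h.exists_entry (show (r, z) ∈ domain R s from ⟨hr, hz⟩)
      · refine (hv1 ha hr.2 hseg).trans ?_
        have e1 := norm_nonneg (v (0, z))
        calc E * (‖dz (domain R s) v (0, z)‖ + K * C * φ * X)
            = E * ‖dz (domain R s) v (0, z)‖ + E * (K * C * X) * φ := by ring
          _ ≤ A * ‖dz (domain R s) v (0, z)‖ + A * φ := by
            gcongr <;> rw [hAe] <;> linarith
          _ ≤ _ := by
            linarith [mul_nonneg hA.le e1]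
      · exact absurd hz0 hlt.not_ge
    · obtain ⟨a, ha, hseg, ⟨-, hle⟩ | ⟨rfl, -⟩⟩ :=
        h.exists_entry (show (r, z) ∈ domain R s from ⟨hr, hz⟩)
      · exact absurd hz0 hle.not_gt
      · refine (hv1 ha hr.2 hseg).trans ?_
        rw [hv.dz_bottom h ⟨ha.1, ha.2.trans hr.2⟩, norm_zero, zero_add]
        calc E * (K * C * φ * X) = E * (K * C * X) * φ := by ring
          _ ≤ A * φ := by gcongr; rw [hAe]; linarith
  · refine sq_normL2_le_of_pointwise h (hv.smooth₂ h).continuousOn hv.smooth.continuousOn hr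
      (fun z hz hz0 => ?_) fun z hz hz0 => ?_
    · obtain ⟨a, ha, hseg, ⟨rfl, -⟩ | ⟨-, hlt⟩⟩ :=
        h.exists_entry (show (r, z) ∈ domain R s from ⟨hr, hz⟩)
      · refine (hv2 ha hr.2 hseg).trans ?_
        calc E * (‖dz (domain R s) (dz (domain R s) v) (0, z)‖ +
              (K * (C * φ + E * (‖v (0, z)‖ + K * C * φ * X))) * X)
            = E * ‖dz (domain R s) (dz (domain R s) v) (0, z)‖ +
              E * (K * E * X) * ‖v (0, z)‖ +
              (E * (K * C * X) + E * (K * (E * (K * C * X)) * X)) * φ := by ring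
          _ ≤ A * ‖dz (domain R s) (dz (domain R s) v) (0, z)‖ + A * ‖v (0, z)‖ + A * φ := by
            gcongr <;> rw [hAe] <;> linarith
          _ = _ := by ring
      · exact absurd hz0 hlt.not_ge
    · obtain ⟨a, ha, hseg, ⟨-, hle⟩ | ⟨rfl, -⟩⟩ :=
        h.exists_entry (show (r, z) ∈ domain R s from ⟨hr, hz⟩)
      · exact absurd hz0 hle.not_gt
      · have haR : a ∈ Icc 0 R := ⟨ha.1, ha.2.trans hr.2⟩
        refine (hv2 ha hr.2 hseg).trans ?_
        -- Dividing the bottom identity by `s'`, which is at least `c`, turns the bound on the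
        -- defect of `v_z` into one on the entry value of `v_zz`.
        have hb : ‖dz (domain R s) (dz (domain R s) v) (a, s a)‖ ≤ K * C * φ / c := by
          have e1 := congrArg norm (hv.deriv_smul_dz_dz_bottom h haR)
          rw [norm_neg, norm_smul, Real.norm_of_nonneg (h.deriv_pos a haR).le] at e1
          have e2 := (hK v₀ v hv a haR (s a) ⟨(h.pos a haR).le, le_rfl⟩).2.1.trans (hKC a haR)
          rw [← e1] at e2
          rw [le_div_iff₀ hc0, mul_comm]
          exact (mul_le_mul_of_nonneg_right (hc a haR) (norm_nonneg _)).trans e2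
        rw [hv.bottom a haR, norm_zero, zero_add]
        calc E * (‖dz (domain R s) (dz (domain R s) v) (a, s a)‖ +
              (K * (C * φ + E * (K * C * φ * X))) * X)
            ≤ E * (K * C * φ / c + (K * (C * φ + E * (K * C * φ * X))) * X) := by gcongr
          _ = (E * (K * C / c) + E * (K * C * X) + E * (K * (E * (K * C * X)) * X)) * φ := by
            ring
          _ ≤ A * φ := by gcongr; rw [hAe]; linarith

theorem DefectBound.stable {K : ℝ} (hK : DefectBound α p q R s β K) (hK0 : 0 < K)
    (h : Downsloping R s) :
    Stable normL2 α p q R s β ∧ Stable normH1 α p q R s β ∧ Stable normH2 α p q R s β := by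
  obtain ⟨C, hC0, hC⟩ := hK.exists_normL2_le hK0 h
  obtain ⟨C', hC'0, hC'⟩ := hK.exists_normL2_dz_le hK0 h
  have h0R : (0 : ℝ) ∈ Icc 0 R := ⟨le_rfl, h.pos_R.le⟩
  have hs0 := h.pos 0 h0R
  have hsq : ∀ {v₀ : ℝ → ℂ} {v : ℝ × ℝ → ℂ}, IsSolution α p q R s β v₀ v → ∀ r ∈ Icc 0 R,
      normL2 (s r) (fun z => v (r, z)) ^ 2 ≤ C ^ 2 * normL2 (s 0) (fun z => v (0, z)) ^ 2 := by
    intro v₀ v hv r hr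
    rw [← mul_pow]
    exact pow_le_pow_left₀ (normL2_nonneg _ _) (hC v₀ v hv r hr) 2
  have hderiv : ∀ {v₀ : ℝ → ℂ} {v : ℝ × ℝ → ℂ}, IsSolution α p q R s β v₀ v → ∀ r ∈ Icc 0 R,
      ∀ z ∈ Icc 0 (s r), HasDerivWithinAt (fun z => v (r, z)) (dz (domain R s) v (r, z))
        (Icc 0 (s r)) z := fun hv r hr z hz =>
    hasDerivWithinAt_depth (hv.smooth.differentiableOn (by norm_num)) ⟨hr, hz⟩
  have hderiv₁ : ∀ {v₀ : ℝ → ℂ} {v : ℝ × ℝ → ℂ}, IsSolution α p q R s β v₀ v → ∀ r ∈ Icc 0 R,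
      ∀ z ∈ Icc 0 (s r), HasDerivWithinAt (fun z => dz (domain R s) v (r, z))
        (dz (domain R s) (dz (domain R s) v) (r, z)) (Icc 0 (s r)) z := fun hv r hr z hz =>
    hasDerivWithinAt_depth ((hv.smooth₁ h).differentiableOn (by norm_num)) ⟨hr, hz⟩
  refine ⟨⟨C, hC0, fun v₀ v hv r hr => ?_⟩,
    ⟨Real.sqrt (C ^ 2 + C'), Real.sqrt_pos.2 (by positivity), fun v₀ v hv r hr => ?_⟩,
    ⟨Real.sqrt (C ^ 2 + 2 * C'), Real.sqrt_pos.2 (by positivity), fun v₀ v hv r hr => ?_⟩⟩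
  · rw [normL2_congr hs0.le fun z hz => (hv.initial z hz).symm]
    exact hC v₀ v hv r hr
  · rw [normH1_congr hs0.le fun z hz => (hv.initial z hz).symm,
      normH1_eq (h.pos r hr) (hderiv hv r hr), normH1_eq hs0 (hderiv hv 0 h0R),
      ← Real.sqrt_mul (by positivity)]
    refine Real.sqrt_le_sqrt ?_
    have e0 := hsq hv r hr
    have e1 := (hC' v₀ v hv r hr).1
    nlinarith [mul_nonneg (sq_nonneg C)
      (sq_nonneg (normL2 (s 0) (fun z => dz (domain R s) v (0, z))))]
  · rw [normH2_congr hs0.le fun z hz => (hv.initial z hz).symm,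
      normH2_eq (h.pos r hr) (hderiv hv r hr) (hderiv₁ hv r hr),
      normH2_eq hs0 (hderiv hv 0 h0R) (hderiv₁ hv 0 h0R), ← Real.sqrt_mul (by positivity)]
    refine Real.sqrt_le_sqrt ?_
    have e0 := hsq hv r hr
    obtain ⟨e1, e2⟩ := hC' v₀ v hv r hr
    have n1 := sq_nonneg (normL2 (s 0) (fun z => dz (domain R s) v (0, z)))
    have n2 := sq_nonneg (normL2 (s 0) (fun z => dz (domain R s) (dz (domain R s) v) (0, z)))
    nlinarith [mul_nonneg (sq_nonneg C) n1, mul_nonneg (sq_nonneg C) n2,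
      mul_nonneg hC'0.le n1, mul_nonneg hC'0.le n2]

end Stability

end WideAngle

theorem mainTheorem1 (M : ℝ) :
    ∃ δ : ℝ, 0 < δ ∧
      ∀ (α : ℝ) (p q : ℂ) (R : ℝ) (s : ℝ → ℝ) (β : ℝ × ℝ → ℂ),
        0 < α → q ≠ 0 → 0 < R →
        ContDiffOn ℝ 1 s (Set.Icc 0 R) →
        (∀ r ∈ Set.Icc 0 R, 0 < s r) →
        (∀ r ∈ Set.Icc 0 R, 0 < derivWithin s (Set.Icc 0 R) r) →
        ContinuousOn β (WideAngle.domain R s) →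
        ((∀ x ∈ WideAngle.domain R s, 0 < (q⁻¹ + β x).im) ∨
          (∀ x ∈ WideAngle.domain R s, (q⁻¹ + β x).im < 0) ∨
          ((∀ x ∈ WideAngle.domain R s, |(q⁻¹ + β x).re| ≤ M) ∧
            ∀ r ∈ Set.Icc 0 R, s r / α ≤ δ)) →
        WideAngle.Stable WideAngle.normL2 α p q R s β ∧
          WideAngle.Stable WideAngle.normH1 α p q R s β ∧
          WideAngle.Stable WideAngle.normH2 α p q R s β := by
  -- Any `δ` with `(|M| + 1 / 2) * δ ^ 2 ≤ 1 / 2` serves, the absorption condition in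
  -- `gradientBound_of_re`.
  refine ⟨1 / (2 * (|M| + 1)), by positivity, ?_⟩
  intro α p q R s β hα hq hR hs hs0 hs1 hβ hcond
  have h : WideAngle.Downsloping R s := ⟨hR, hs, hs0, hs1⟩
  have hγ : ContinuousOn (fun x => q⁻¹ + β x) (WideAngle.domain R s) := continuousOn_const.add hβ
  obtain ⟨C, hC0, hC⟩ : ∃ C, 0 ≤ C ∧ WideAngle.GradientBound α R s (fun x => q⁻¹ + β x) C := by
    rcases hcond with hpos | hneg | ⟨hre, hδ⟩
    · exact WideAngle.exists_gradientBound_of_im h hα hγ (σ := 1) (by simp)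
        fun x hx => by simpa using hpos x hx
    · exact WideAngle.exists_gradientBound_of_im h hα hγ (σ := -1) (by simp)
        fun x hx => by rw [neg_one_mul]; exact neg_pos.2 (hneg x hx)
    · refine ⟨1 / α ^ 2, by positivity, WideAngle.gradientBound_of_re hα hre ?_ hδ⟩
      have hM := abs_nonneg M
      rw [div_pow, mul_div_assoc', div_le_iff₀ (by positivity)]
      nlinarith
  obtain ⟨K, hK0, hK⟩ := WideAngle.exists_defectBound (p := p) h hα hq hβ hC0 hC
  exact hK.stable hK0 h
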